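/- **Setting.** Let $\mathscr X,\mathscr Y$ be measurable spaces, $\mu$ (written $dx$) a $\sigma$-finite reference measure on $\mathscr X$, and let $p\ge 1$, $m\ge 1$ be integers. The $p$ source domains are distributions on $\mathscr X\times\mathscr Y$ with a common conditional law $\mathscr D(\cdot\mid x)$ of $y$ given $x$: $\mathscr D_k(x,y)=\mathscr D_k(x)\,\mathscr D(y\mid x)$, where $\mathscr D_k(x)$ is a probability density with respect to $\mu$. Let $\Delta$ be the probability simplex in $\mathbb R^p$; a target mixture is $\mathscr D_T=\sum_k\lambda_k\mathscr D_k$ with $\lambda\in\Delta$. *Predictors and losses.* One of the following two models holds. (R) Regression: $h_k:\mathscr X\to\mathbb R$, $\ell:\mathbb R\times\mathscr Y\to\mathbb R_+$ is convex and continuous in its first argument, and $\mathcal L(\mathscr D,h)=\mathbb E_{(x,y)\sim\mathscr D}[\ell(h(x),y)]$. (P) Probability: $h_k:\mathscr X\times\mathscr Y\to[0,1]$ with $\sum_{y}h_k(x,y)=1$ for all $x$, $\ell:[0,1]\to[0,+\infty]$ is convex and continuous, and $\mathcal L(\mathscr D,h)=\mathbb E_{(x,y)\sim\mathscr D}[\ell(h(x,y))]$.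 In both models, $\mathcal L(\mathscr D_k,h_k)\le\epsilon$ for all $k$, for some $\epsilon>0$, and the losses of the $h_k$ are at most $M<\infty$ at every $(x,y)$. *Kernel density estimation.* Let $K_\sigma:\mathscr X\times\mathscr X\to(0,\infty)$ satisfy $\int K_\sigma(x,x')\,dx=1$ for all $x'$. Draw $S=((x_1,k_1),\dots,(x_m,k_m))$ i.i.d. from $\mathscr Q(x,k)=\frac1p\mathscr D_k(x)$ on $\mathscr X\times[p]$. Let $m_k$ be the number of points labeled $k$, and put $\widehat{\mathscr D}_k(x)=\frac1{m_k}\sum_{i:k_i=k}K_\sigma(x,x_i)$ (and $\widehat{\mathscr D}_k=0$ if $m_k=0$). For $z\in\Delta$, the GMSA predictor is $$\widehat h_z=\sum_{k=1}^p\frac{z_k\widehat{\mathscr D}_k(x)}{\sum_{j=1}^pz_j\widehat{\mathscr D}_j(x)}\,h_k ,$$ where $h_k$ stands for $h_k(x)$ in model (R) and for $h_k(x,y)$ in model (P) (a weight $0/0$ is read as $0$). *Divergences.* For densities $P,Q$ on $\mathscr X$ let $\mathsf d_\alpha(P\,\|\,Q)=\big[\int P\,(P/Q)^{\alpha-1}\,dx\big]^{1/(\alpha-1)}$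 for $\alpha>1$, and $\mathsf d_{+\infty}(P\,\|\,Q)=\lim_{\alpha\to\infty}\mathsf d_\alpha(P\,\|\,Q)$, i.e. the $P$-essential supremum of $P/Q$. Put $$\kappa=\sup_{x,x',x''\in\mathscr X}\frac{K_\sigma(x,x')}{K_\sigma(x,x'')},\qquad \mathsf d^*=\max_{k\in[p]}\mathbb E_{x\sim\mathscr D_k}\big[\mathsf d_{+\infty}(K_\sigma(\cdot,x)\,\|\,\mathscr D_k)\big],\qquad \mathsf d'^*=\max_{k\in[p]}\mathbb E_{x\sim\mathscr D_k}\big[\mathsf d_{+\infty}(\mathscr D_k\,\|\,K_\sigma(\cdot,x))\big],$$ all of which may be $+\infty$. **Theorem (GMSA).** There exists $z\in\Delta$ such that, for any $\delta>0$, with probability at least $1-\delta$ over the sample $S$, the following holds for every target mixture $\mathscr D_T$: $$\mathcal L(\mathscr D_T,\widehat h_z)\le\epsilon^{1/4}M^{3/4}\, \exp\!\Big(\frac{6\kappa}{\sqrt{2(m/p)}}\sqrt{\log p+\log(1/\delta)}\Big)\,\mathsf d^*\,\mathsf d'^* .$$ (In the exponent, the square root of a negative number, possible only for $\delta>1$,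 and the product $\infty\cdot 0$ are read as $0$; in the product on the right, $0\cdot\infty=0$.) -/

import Mathlib

open MeasureTheory ProbabilityTheory Filter Topology Function
open scoped ENNReal NNReal

noncomputable section

namespace MSA

/-- The exponential `d_α(P ‖ Q) = (∫ P (P / Q) ^ (α - 1) dμ) ^ (1 / (α - 1))` of the Rényi
divergence of order `α > 1` between the distributions with densities `P` and `Q` with respect
to `μ`. (In `ℝ≥0∞`, the integrand is `0` where `P = 0`, and `∞` where `P > 0 = Q`.) -/
def renyiExp {X : Type*} [MeasurableSpace X] (μ : Measure X) (α : ℝ) (P Q : X → ℝ≥0) : ℝ≥0∞ :=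
  (∫⁻ x, (P x : ℝ≥0∞) * ((P x : ℝ≥0∞) / (Q x : ℝ≥0∞)) ^ (α - 1) ∂μ) ^ (1 / (α - 1))

/-- The exponential `d_∞(P ‖ Q)` of the Rényi divergence of order `∞`: the limit of
`d_α(P ‖ Q)` as `α → ∞`. The limit exists and is `ess sup_P (P / Q)`, see
`tendsto_renyiExp` and `renyiExpTop_eq_essSup`. -/
def renyiExpTop {X : Type*} [MeasurableSpace X] (μ : Measure X) (P Q : X → ℝ≥0) : ℝ≥0∞ :=
  limUnder atTop (fun α : ℝ => renyiExp μ α P Q)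

/-- The distribution on `X` with density `f` with respect to `μ`. -/
def law {X : Type*} [MeasurableSpace X] (μ : Measure X) (f : X → ℝ≥0) : Measure X :=
  μ.withDensity (fun x => (f x : ℝ≥0∞))

theorem tendsto_renyiExp {X : Type*} [MeasurableSpace X] (μ : Measure X) (P Q : X → ℝ≥0)
    (hP : Measurable P) (hQ : Measurable Q) (hP1 : ∫⁻ x, (P x : ℝ≥0∞) ∂μ = 1) :
    Tendsto (fun α : ℝ => renyiExp μ α P Q) atTop
      (𝓝 (essSup (fun x => (P x : ℝ≥0∞) / (Q x : ℝ≥0∞)) (law μ P))) := by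
  set f : X → ℝ≥0∞ := fun x => (P x : ℝ≥0∞) / (Q x : ℝ≥0∞) with hf
  have hfm : Measurable f := hP.coe_nnreal_ennreal.div hQ.coe_nnreal_ennreal
  have hprob : law μ P Set.univ = 1 := by simp [law, hP1]
  have key : ∀ α : ℝ, renyiExp μ α P Q = (∫⁻ x, f x ^ (α - 1) ∂(law μ P)) ^ (1 / (α - 1)) := by
    intro α
    unfold renyiExp law
    rw [lintegral_withDensity_eq_lintegral_mul _ hP.coe_nnreal_ennreal (hfm.pow_const _)]
    rfl
  have hexp : Tendsto (fun α : ℝ => 1 / (α - 1)) atTop (𝓝 0) := by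
    simp only [one_div]
    exact tendsto_inv_atTop_zero.comp (tendsto_atTop_add_const_right _ (-1) tendsto_id)
  refine tendsto_order.2 ⟨fun a ha => ?_, fun a ha => ?_⟩
  · obtain ⟨c, hac, hc⟩ := exists_between ha
    have hpos : law μ P {x | c < f x} ≠ 0 := by
      intro h0
      have : f ≤ᵐ[law μ P] fun _ => c := by
        rw [EventuallyLE, ae_iff]
        simpa using h0
      exact absurd (essSup_le_of_ae_le c this) (not_le.2 hc)
    set w := law μ P {x | c < f x} with hw
    have hwtop : w ≠ ∞ := ne_top_of_le_ne_top ENNReal.one_ne_top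
      (hprob ▸ measure_mono (Set.subset_univ _))
    have hctop : c ≠ ∞ := ne_top_of_lt hc
    have hlim : Tendsto (fun α : ℝ => c * w ^ (1 / (α - 1))) atTop (𝓝 (c * w ^ (0 : ℝ))) := by
      refine ENNReal.Tendsto.const_mul ?_ (Or.inr hctop)
      have hc0 : ContinuousAt (fun t : ℝ => w ^ t) 0 := by
        clear_value w
        clear hw
        lift w to ℝ≥0 using hwtop
        have hw0 : w ≠ 0 := by simpa using hpos
        simp only [← ENNReal.coe_rpow_of_ne_zero hw0]
        exact ENNReal.continuous_coe.continuousAt.comp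
          ((NNReal.continuousAt_rpow (x := w) (y := 0) (Or.inl hw0)).comp
            (f := fun t : ℝ => (w, t)) (by fun_prop))
      exact hc0.tendsto.comp hexp
    rw [ENNReal.rpow_zero, mul_one] at hlim
    filter_upwards [hlim.eventually (lt_mem_nhds hac), eventually_gt_atTop 1] with α h1 h2
    refine h1.trans_le ?_
    have hr : 0 < α - 1 := by linarith
    rw [key, one_div, ENNReal.le_rpow_inv_iff hr, ENNReal.mul_rpow_of_nonneg _ _ hr.le,
      ← ENNReal.rpow_mul, inv_mul_cancel₀ hr.ne', ENNReal.rpow_one]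
    calc c ^ (α - 1) * w = ∫⁻ x in {x | c < f x}, c ^ (α - 1) ∂(law μ P) := by
          rw [setLIntegral_const]
      _ ≤ ∫⁻ x in {x | c < f x}, f x ^ (α - 1) ∂(law μ P) := by
          refine setLIntegral_mono (hfm.pow_const _) fun x hx => ?_
          exact ENNReal.rpow_le_rpow (le_of_lt hx) hr.le
      _ ≤ _ := setLIntegral_le_lintegral _ _
  · filter_upwards [eventually_gt_atTop 1] with α h2
    refine lt_of_le_of_lt ?_ ha
    have hr : 0 < α - 1 := by linarith
    rw [key, one_div, ENNReal.rpow_inv_le_iff hr]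
    calc ∫⁻ x, f x ^ (α - 1) ∂(law μ P)
        ≤ ∫⁻ _, (essSup f (law μ P)) ^ (α - 1) ∂(law μ P) := by
          refine lintegral_mono_ae ?_
          filter_upwards [ae_le_essSup (f := f) (μ := law μ P)] with x hx
          exact ENNReal.rpow_le_rpow hx hr.le
      _ = _ := by rw [lintegral_const, hprob, mul_one]

theorem renyiExpTop_eq_essSup {X : Type*} [MeasurableSpace X] (μ : Measure X) (P Q : X → ℝ≥0)
    (hP : Measurable P) (hQ : Measurable Q) (hP1 : ∫⁻ x, (P x : ℝ≥0∞) ∂μ = 1) :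
    renyiExpTop μ P Q = essSup (fun x => (P x : ℝ≥0∞) / (Q x : ℝ≥0∞)) (law μ P) :=
  (tendsto_renyiExp μ P Q hP hQ hP1).limUnder_eq

/-- The domain on `X × Y` with marginal density `f` and conditional law `η x` of `y` given `x`. -/
def domain {X Y : Type*} [MeasurableSpace X] [MeasurableSpace Y] (μ : Measure X)
    (η : Kernel X Y) (f : X → ℝ≥0) : Measure (X × Y) :=
  (law μ f) ⊗ₘ η

/-- The mixture `∑ k, w k • D k` of the source domains. -/
def mixture {X Y : Type*} [MeasurableSpace X] [MeasurableSpace Y] (μ : Measure X)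
    (η : Kernel X Y) {p : ℕ} (D : Fin p → X → ℝ≥0) (w : Fin p → ℝ≥0) : Measure (X × Y) :=
  ∑ k, w k • domain μ η (D k)

/-- The distribution `Q(x, k) = D k x / p` over `X × [p]` of a labeled sample point. -/
def labeledLaw {X : Type*} [MeasurableSpace X] (μ : Measure X) {p : ℕ}
    (D : Fin p → X → ℝ≥0) : Measure (X × Fin p) :=
  ∑ k, ((p : ℝ≥0)⁻¹) • (law μ (D k)).map (fun x => (x, k))

/-- The distribution of a sample of `m` points drawn i.i.d. from `labeledLaw`. -/
def sampleLaw {X : Type*} [MeasurableSpace X] (μ : Measure X) {p : ℕ}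
    (D : Fin p → X → ℝ≥0) (m : ℕ) : Measure (Fin m → X × Fin p) :=
  Measure.pi (fun _ => labeledLaw μ D)

/-- The kernel density estimate of the `k`-th marginal: the average of `K(·, xᵢ)` over the sample
points labeled `k` (and `0` when there is none). -/
def kde {X : Type*} (K : X → X → ℝ≥0) {p m : ℕ} (S : Fin m → X × Fin p) (k : Fin p) (x : X) :
    ℝ≥0 :=
  (∑ i with (S i).2 = k, K x (S i).1) / ((Finset.univ.filter fun i => (S i).2 = k).card : ℝ≥0)

/-- The distribution-weighted combination
`x ↦ ∑ k, (z k * Dhat k x / ∑ j, z j * Dhat j x) • h k x`. Predictions live in `V = ℝ` in the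
regression model and in `V = Y → ℝ≥0` in the probability model. -/
def gmsa {X V : Type*} [AddCommMonoid V] [Module ℝ≥0 V] {p : ℕ} (z : Fin p → ℝ≥0)
    (Dhat : Fin p → X → ℝ≥0) (h : Fin p → X → V) (x : X) : V :=
  ∑ k, (z k * Dhat k x / ∑ j, z j * Dhat j x) • h k x

/-- Expected loss in the regression model. -/
def lossR {X Y : Type*} [MeasurableSpace X] [MeasurableSpace Y] (ℓ : ℝ → Y → ℝ≥0)
    (P : Measure (X × Y)) (h : X → ℝ) : ℝ≥0∞ :=
  ∫⁻ xy, (ℓ (h xy.1) xy.2 : ℝ≥0∞) ∂P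

/-- Expected loss in the probability model. -/
def lossP {X Y : Type*} [MeasurableSpace X] [MeasurableSpace Y] (ℓ : ℝ≥0 → ℝ≥0∞)
    (P : Measure (X × Y)) (h : X → Y → ℝ≥0) : ℝ≥0∞ :=
  ∫⁻ xy, ℓ (h xy.1 xy.2) ∂P

/-- `κ`, the largest ratio `K x x' / K x x''` (possibly `∞`). -/
def kappa {X : Type*} (K : X → X → ℝ≥0) : ℝ≥0∞ :=
  ⨆ (x : X) (x' : X) (x'' : X), (K x x' : ℝ≥0∞) / (K x x'' : ℝ≥0∞)

/-- `d* = max_k E_{x ∼ D_k} [d_∞(K(·, x) ‖ D_k)]`. -/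
def dStar {X : Type*} [MeasurableSpace X] (μ : Measure X) {p : ℕ} (D : Fin p → X → ℝ≥0)
    (K : X → X → ℝ≥0) : ℝ≥0∞ :=
  ⨆ k, ∫⁻ x, renyiExpTop μ (fun u => K u x) (D k) ∂(law μ (D k))

/-- `d'* = max_k E_{x ∼ D_k} [d_∞(D_k ‖ K(·, x))]`. -/
def dStar' {X : Type*} [MeasurableSpace X] (μ : Measure X) {p : ℕ} (D : Fin p → X → ℝ≥0)
    (K : X → X → ℝ≥0) : ℝ≥0∞ :=
  ⨆ k, ∫⁻ x, renyiExpTop μ (D k) (fun u => K u x) ∂(law μ (D k))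

/-- The bound `ε^{1/4} M^{3/4} exp(6 κ √(log p + log (1/δ)) / √(2 (m/p))) d* d'*`, an element of
`[0, ∞]`. -/
def gmsaBound {X : Type*} [MeasurableSpace X] (μ : Measure X) {p : ℕ} (m : ℕ)
    (D : Fin p → X → ℝ≥0) (K : X → X → ℝ≥0) (ε M : ℝ≥0) (δ : ℝ) : ℝ≥0∞ :=
  ((ε ^ (1 / 4 : ℝ) * M ^ (3 / 4 : ℝ) : ℝ≥0) : ℝ≥0∞)
    * EReal.exp ((kappa K : EReal) *
        ((6 / √(2 * ((m : ℝ) / (p : ℝ))) * √(Real.log p + Real.log (1 / δ)) : ℝ) : EReal))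
    * dStar μ D K * dStar' μ D K

end MSA

end

/-!
Averaging the losses of the predictors `h k` over the conditional law of `y` gives functions `G k`
on `X`, bounded by `M` and with `∫ D k * G k ≤ ε`. By convexity the loss of the combination is at
most that of the same weighted average of the `G k` (`exists_weights_forall_le_average`), and a
mixture of sources satisfies any bound that every source satisfies. So weights `z` are needed for
which `∫ D i * gmsa z (kde K S) G` is small for all `i` and most samples `S`. The weights are chosen
before the sample, from the true densities.

*Choice of the weights.* With `D_z = ∑ z k * D k` and `N_z = ∑ z k * D k * G k`, one has
`gmsa z D G = N_z / D_z`. No fixed point theorem is used: `z` maximizes the concave function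
`∫ D_z * ψ (N_z / D_z)`, where `ψ t = t - t * log t` and the losses are scaled by `M`. Since
`ψ t - t * ψ' t = t` and `ψ' ≥ 0` on `[0, 1]`, first order optimality towards the vertex `i` says
that `∫ D i * N_z / D_z` is at most the maximum, which is at most `ε * (1 + log (M / ε))`.
Restricting `z` to weights at least `1 / (9 p)` costs a factor `9 / 8` and keeps all weights
positive, so that the denominators of the combination never vanish (`exists_weights`).

*From `ε * (1 + log (M / ε))` to `ε ^ (1 / 4) * M ^ (3 / 4)`.* Write `d = dStar` and `d' = dStar'`.
The loss never exceeds `M`, so one may assume `(d * d') ^ 4 < M / ε`. If `d * d' ≥ 3 / 2`, then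
`M / ε` is large and the logarithm is absorbed. If `d * d' ≤ 3 / 2`, any two source densities agree
up to the factor `(d * d') ^ 2` (`ae_le_sq_mul_of_forall_ae_le`) and any weights will do. Both cases
are in `lintegral_mul_gmsa_le_geom_mean`.

*Sampling.* The functions `g k x = d_∞(K(·, x) ‖ D k)` and `g' k x = d_∞(D k ‖ K(·, x))` vary at most
by the factor `κ`. If their averages over the sample points labeled `k` are at most `1 + τ` times
`d` and `d'`, the estimates satisfy `kde ≤ (1 + τ) d D k` and, by Cauchy–Schwarz,
`D k ≤ (1 + τ) d' kde`. This changes the loss by a factor at most `(1 + τ) ^ 2 * d * d'`, and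
`(1 + τ) ^ 2 ≤ exp (2 * τ)`. Hoeffding's lemma, applied to all sample points at once so that the
number of points labeled `k` need not be controlled, bounds the probability of failure. When the
sample is too small for this, the exponential in the bound is at least `κ ^ 2`, and a comparison of
all the sources with one another suffices (`sampleLaw_loss_le`).
-/

namespace MSA

/-! ### A concave potential -/

/-- The density `D * ψ (N / D)` with `ψ t = t - t * log t`, as a function of the density `D` of a
mixture and the density `N ≤ D` of its loss. It is homogeneous of degree one and concave. -/
noncomputable def entropyPotential (D N : ℝ) : ℝ := N + D * Real.negMulLog (N / D)

lemma add_negMulLog_le {s t : ℝ} (hs : 0 < s) (hst : s ≤ t) (ht : t ≤ 1) :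
    s + Real.negMulLog s ≤ t + Real.negMulLog t := by
  have ht0 : 0 < t := hs.trans_le hst
  have h1 : Real.log (t / s) ≤ t / s - 1 := Real.log_le_sub_one_of_pos (by positivity)
  rw [Real.log_div ht0.ne' hs.ne'] at h1
  have h2 : Real.log t ≤ 0 := Real.log_nonpos ht0.le ht
  have h3 : s * (Real.log t - Real.log s) ≤ t - s := by
    calc s * (Real.log t - Real.log s) ≤ s * (t / s - 1) := by gcongr
      _ = t - s := by field_simp
  simp only [Real.negMulLog]
  nlinarith [mul_nonneg (sub_nonneg.2 hst) (neg_nonneg.2 h2)]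

lemma entropyPotential_nonneg {D N : ℝ} (hN : 0 ≤ N) (hND : N ≤ D) :
    0 ≤ entropyPotential D N := by
  have hD := hN.trans hND
  exact add_nonneg hN (mul_nonneg hD
    (Real.negMulLog_nonneg (by positivity) (div_le_one_of_le₀ hND hD)))

lemma entropyPotential_le {D N ε : ℝ} (hN : 0 ≤ N) (hND : N ≤ D) (hε : 0 < ε) :
    entropyPotential D N ≤ N * Real.log (1 / ε) + ε * D := by
  rcases hN.eq_or_lt with rfl | hN
  · have : 0 ≤ ε * D := by positivity
    simpa [entropyPotential] using this
  have hD := hN.trans_le hND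
  have h := Real.log_le_sub_one_of_pos (show 0 < ε * D / N by positivity)
  rw [Real.log_div (by positivity) hN.ne', Real.log_mul hε.ne' hD.ne'] at h
  have h2 : N * (Real.log ε + Real.log D - Real.log N) ≤ ε * D - N := by
    calc _ ≤ N * (ε * D / N - 1) := by gcongr
      _ = _ := by field_simp
  have h3 : D * Real.negMulLog (N / D) = - (N * (Real.log N - Real.log D)) := by
    rw [Real.negMulLog, Real.log_div hN.ne' hD.ne']; field_simp
  rw [entropyPotential, h3, one_div, Real.log_inv]
  linarith

lemma entropyPotential_le_self {D N : ℝ} (hN : 0 ≤ N) (hND : N ≤ D) :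
    entropyPotential D N ≤ D := by
  simpa using entropyPotential_le hN hND one_pos

/-- Quantitative concavity of the potential: moving from `(D, N)` towards `(D', N')` gains at least
the first order term in the direction of `D'`. The contribution of `N'` is dropped, since the
potential increases with its second argument. -/
lemma entropyPotential_perturb {D N D' N' C t : ℝ} (hD : 0 < D) (hN : 0 ≤ N) (hND : N ≤ D)
    (hN' : 0 ≤ N') (hND' : N' ≤ D') (hC : D' ≤ C * D) (ht : 0 < t) (ht1 : t < 1) :
    (1 - t) * entropyPotential D N + t * (1 - t) / (1 - t + C * t) * (N * D' / D) ≤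
      entropyPotential ((1 - t) * D + t * D') ((1 - t) * N + t * N') := by
  have h1t : 0 < 1 - t := sub_pos.2 ht1
  have hD' : 0 ≤ D' := hN'.trans hND'
  have hC0 : 0 ≤ C := by
    by_contra h
    nlinarith
  set E := (1 - t) * D + t * D' with hE
  have hE0 : 0 < E := by positivity
  have hle : (1 - t) * N + t * N' ≤ E := by
    rw [hE]; gcongr
  rcases hN.eq_or_lt with rfl | hN
  · have := entropyPotential_nonneg (D := E) (N := (1 - t) * 0 + t * N') (by positivity) hle
    simpa [entropyPotential] using this
  have hmono := add_negMulLog_le (s := (1 - t) * N / E) (t := ((1 - t) * N + t * N') / E)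
    (by positivity) (by gcongr; nlinarith [mul_nonneg ht.le hN'])
    (div_le_one_of_le₀ hle hE0.le)
  have hlog := Real.one_sub_inv_le_log_of_pos (show 0 < E / ((1 - t) * D) by positivity)
  have hEC : E ≤ D * (1 - t + C * t) := by
    rw [hE]; nlinarith
  have hq : t * D' / (D * (1 - t + C * t)) ≤ Real.log (E / ((1 - t) * D)) := by
    refine le_trans ?_ hlog
    calc t * D' / (D * (1 - t + C * t)) ≤ t * D' / E := by gcongr
      _ = _ := by rw [inv_div, hE]; field_simp; ring
  have hexp : Real.log ((1 - t) * N / E) = Real.log (N / D) - Real.log (E / ((1 - t) * D)) := by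
    rw [← Real.log_div (by positivity) (by positivity)]
    congr 1
    field_simp
  calc (1 - t) * entropyPotential D N + t * (1 - t) / (1 - t + C * t) * (N * D' / D)
      = (1 - t) * N - (1 - t) * N * Real.log (N / D)
          + (1 - t) * N * (t * D' / (D * (1 - t + C * t))) := by
        rw [entropyPotential, Real.negMulLog]; field_simp; ring
    _ ≤ (1 - t) * N - (1 - t) * N * Real.log (N / D)
          + (1 - t) * N * Real.log (E / ((1 - t) * D)) := by gcongr
    _ = E * ((1 - t) * N / E + Real.negMulLog ((1 - t) * N / E)) := by
        rw [Real.negMulLog, hexp]; field_simp; ring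
    _ ≤ E * (((1 - t) * N + t * N') / E + Real.negMulLog (((1 - t) * N + t * N') / E)) := by
        gcongr
    _ = _ := by rw [entropyPotential]; field_simp

/-! ### Maximizing the potential over the weights -/

lemma measurable_entropyPotential : Measurable (fun q : ℝ × ℝ => entropyPotential q.1 q.2) := by
  unfold entropyPotential
  exact measurable_snd.add (measurable_fst.mul
    (Real.continuous_negMulLog.measurable.comp (measurable_snd.div measurable_fst)))

/-- The integrated potential `∫ D ψ (N / D)` of the mixtures `D = ∑ z k * D k` of the densities
and `N = ∑ z k * (D k * G k)` of their losses. -/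
noncomputable def mixPotential {X : Type*} [MeasurableSpace X] (μ : Measure X) {p : ℕ}
    (D G : Fin p → X → ℝ) (z : Fin p → ℝ) : ℝ :=
  ∫ x, entropyPotential (∑ k, z k * D k x) (∑ k, z k * (D k x * G k x)) ∂μ

/-- The weights on `Fin p` that are bounded below by `η`. -/
def truncatedSimplex (p : ℕ) (η : ℝ) : Set (Fin p → ℝ) := {z | (∀ k, η ≤ z k) ∧ ∑ k, z k = 1}

lemma isCompact_truncatedSimplex (p : ℕ) {η : ℝ} (hη : 0 ≤ η) :
    IsCompact (truncatedSimplex p η) := by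
  refine (isCompact_stdSimplex ℝ (Fin p)).of_isClosed_subset ?_
    fun z hz => ⟨fun k => hη.trans (hz.1 k), hz.2⟩
  have : truncatedSimplex p η = (⋂ k, {z | η ≤ z k}) ∩ {z | ∑ k, z k = 1} := by
    ext; simp [truncatedSimplex]
  rw [this]
  exact (isClosed_iInter fun k => isClosed_le continuous_const (continuous_apply k)).inter
    (isClosed_eq (by fun_prop) continuous_const)

section Mixture

variable {X : Type*} {p : ℕ} {D G : Fin p → X → ℝ}

lemma mixLoss_le (hD0 : ∀ k x, 0 ≤ D k x) (hG1 : ∀ k x, G k x ≤ 1) {z : Fin p → ℝ}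
    (hz : ∀ k, 0 ≤ z k) (x : X) : ∑ k, z k * (D k x * G k x) ≤ ∑ k, z k * D k x :=
  Finset.sum_le_sum fun k _ => mul_le_mul_of_nonneg_left
    (mul_le_of_le_one_right (hD0 k x) (hG1 k x)) (hz k)

lemma mixLoss_nonneg (hD0 : ∀ k x, 0 ≤ D k x) (hG0 : ∀ k x, 0 ≤ G k x) {z : Fin p → ℝ}
    (hz : ∀ k, 0 ≤ z k) (x : X) : 0 ≤ ∑ k, z k * (D k x * G k x) :=
  Finset.sum_nonneg fun k _ => mul_nonneg (hz k) (mul_nonneg (hD0 k x) (hG0 k x))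

lemma mix_le_sum (hD0 : ∀ k x, 0 ≤ D k x) {z : Fin p → ℝ}
    (hz : ∀ k, 0 ≤ z k) (hz1 : ∑ k, z k = 1) (x : X) : ∑ k, z k * D k x ≤ ∑ k, D k x :=
  Finset.sum_le_sum fun k _ => mul_le_of_le_one_left (hD0 k x)
    (hz1 ▸ Finset.single_le_sum (fun j _ => hz j) (Finset.mem_univ k))

lemma norm_entropyPotential_le (hD0 : ∀ k x, 0 ≤ D k x) (hG0 : ∀ k x, 0 ≤ G k x)
    (hG1 : ∀ k x, G k x ≤ 1) {z : Fin p → ℝ} (hz : ∀ k, 0 ≤ z k) (hz1 : ∑ k, z k = 1) (x : X) :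
    ‖entropyPotential (∑ k, z k * D k x) (∑ k, z k * (D k x * G k x))‖ ≤ ∑ k, D k x := by
  rw [Real.norm_of_nonneg (entropyPotential_nonneg (mixLoss_nonneg hD0 hG0 hz x)
    (mixLoss_le hD0 hG1 hz x))]
  exact (entropyPotential_le_self (mixLoss_nonneg hD0 hG0 hz x)
    (mixLoss_le hD0 hG1 hz x)).trans (mix_le_sum hD0 hz hz1 x)

end Mixture

section Potential

variable {X : Type*} [MeasurableSpace X] {μ : Measure X} {p : ℕ} {D G : Fin p → X → ℝ}

lemma aestronglyMeasurable_entropyPotential (hD : ∀ k, Measurable (D k))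
    (hG : ∀ k, Measurable (G k)) (z : Fin p → ℝ) :
    AEStronglyMeasurable
      (fun x => entropyPotential (∑ k, z k * D k x) (∑ k, z k * (D k x * G k x))) μ :=
  (measurable_entropyPotential.comp
    (f := fun x => (∑ k, z k * D k x, ∑ k, z k * (D k x * G k x))) (by fun_prop)).aestronglyMeasurable

lemma integrable_entropyPotential (hD : ∀ k, Measurable (D k)) (hG : ∀ k, Measurable (G k))
    (hD0 : ∀ k x, 0 ≤ D k x) (hG0 : ∀ k x, 0 ≤ G k x) (hG1 : ∀ k x, G k x ≤ 1)
    (hDi : ∀ k, Integrable (D k) μ) {z : Fin p → ℝ} (hz : ∀ k, 0 ≤ z k) (hz1 : ∑ k, z k = 1) :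
    Integrable
      (fun x => entropyPotential (∑ k, z k * D k x) (∑ k, z k * (D k x * G k x))) μ :=
  (integrable_finsetSum _ fun k _ => hDi k).mono'
    (aestronglyMeasurable_entropyPotential hD hG z)
    (ae_of_all _ (norm_entropyPotential_le hD0 hG0 hG1 hz hz1))

lemma continuousOn_mixPotential (hD : ∀ k, Measurable (D k)) (hG : ∀ k, Measurable (G k))
    (hD0 : ∀ k x, 0 ≤ D k x) (hG0 : ∀ k x, 0 ≤ G k x) (hG1 : ∀ k x, G k x ≤ 1)
    (hDi : ∀ k, Integrable (D k) μ) {η : ℝ} (hη : 0 < η) :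
    ContinuousOn (mixPotential μ D G) (truncatedSimplex p η) := by
  refine continuousOn_of_dominated (bound := fun x => ∑ k, D k x)
    (fun z _ => aestronglyMeasurable_entropyPotential hD hG z)
    (fun z hz => ae_of_all _
      (norm_entropyPotential_le hD0 hG0 hG1 (fun k => hη.le.trans (hz.1 k)) hz.2))
    (integrable_finsetSum _ fun k _ => hDi k) (ae_of_all _ fun x => ?_)
  by_cases h : ∀ k, D k x = 0
  · simp only [h, mul_zero, zero_mul, Finset.sum_const_zero]
    exact continuousOn_const
  push Not at h
  obtain ⟨k, hk⟩ := h
  have hpos : ∀ z ∈ truncatedSimplex p η, (∑ k, z k * D k x) ≠ 0 := fun z hz =>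
    (Finset.sum_pos' (fun j _ => mul_nonneg (hη.le.trans (hz.1 j)) (hD0 j x))
      ⟨k, Finset.mem_univ k, mul_pos (hη.trans_le (hz.1 k)) ((hD0 k x).lt_of_ne' hk)⟩).ne'
  unfold entropyPotential
  refine ContinuousOn.add (by fun_prop) (ContinuousOn.mul (by fun_prop)
    (Real.continuous_negMulLog.comp_continuousOn (ContinuousOn.div (by fun_prop) (by fun_prop) hpos)))

/-- First order optimality of a maximizer of the potential: the loss of the distribution-weighted
combination with weights `z` is bounded on every source domain. The direction used at `i` is the
point of the truncated simplex nearest to the vertex `i`, which costs the factor `8 / 9`. -/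
lemma exists_weights_of_le_one (hp : 0 < p) (hD : ∀ k, Measurable (D k))
    (hG : ∀ k, Measurable (G k))
    (hD0 : ∀ k x, 0 ≤ D k x) (hG0 : ∀ k x, 0 ≤ G k x) (hG1 : ∀ k x, G k x ≤ 1)
    (hDi : ∀ k, Integrable (D k) μ) (hD1 : ∀ k, ∫ x, D k x ∂μ = 1)
    {ε : ℝ} (hε : 0 < ε) (hε1 : ε ≤ 1) (hDG : ∀ k, ∫ x, D k x * G k x ∂μ ≤ ε) :
    ∃ z : Fin p → ℝ, (∀ k, 0 < z k) ∧ ∑ k, z k = 1 ∧ ∀ i,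
      ∫ x, D i x * ((∑ k, z k * (D k x * G k x)) / ∑ k, z k * D k x) ∂μ
        ≤ 9 / 8 * (ε * (1 + Real.log (1 / ε))) := by
  have hp' : (0 : ℝ) < p := by exact_mod_cast hp
  set η : ℝ := 1 / (9 * p) with hη_def
  have hη : 0 < η := by positivity
  have hpη : p * η = 1 / 9 := by rw [hη_def]; field_simp
  obtain ⟨z, hz, hmax⟩ := (isCompact_truncatedSimplex p hη.le).exists_isMaxOn
    ⟨fun _ => 1 / p, fun k => by
      rw [hη_def]; exact one_div_le_one_div_of_le hp' (by linarith), by simp [hp'.ne']⟩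
    (continuousOn_mixPotential hD hG hD0 hG0 hG1 hDi hη)
  have hz0 : ∀ k, 0 < z k := fun k => hη.trans_le (hz.1 k)
  refine ⟨z, hz0, hz.2, fun i => ?_⟩
  have hDGi : ∀ k, Integrable (fun x => D k x * G k x) μ := fun k =>
    (hDi k).mono' ((hD k).mul (hG k)).aestronglyMeasurable (ae_of_all _ fun x => by
      rw [Real.norm_of_nonneg (mul_nonneg (hD0 k x) (hG0 k x))]
      exact mul_le_of_le_one_right (hD0 k x) (hG1 k x))
  -- the direction of perturbation
  set q : Fin p → ℝ := fun k => η + if k = i then 8 / 9 else 0 with hq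
  have hq0 : ∀ k, 0 ≤ q k := fun k => by
    simp only [hq]; split_ifs <;> linarith
  have hqsum : ∑ k, q k = 1 := by
    simp only [hq, Finset.sum_add_distrib, Finset.sum_const, Finset.card_univ, Fintype.card_fin,
      nsmul_eq_mul, hpη, Finset.sum_ite_eq', Finset.mem_univ, if_true]
    norm_num
  have hqz : q ∈ truncatedSimplex p η :=
    ⟨fun k => by simp only [hq]; split_ifs <;> linarith, hqsum⟩
  set N : X → ℝ := fun x => ∑ k, z k * (D k x * G k x) with hN
  set A : X → ℝ := fun x => ∑ k, z k * D k x with hA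
  have hA0 : ∀ x, 0 ≤ A x := fun x => Finset.sum_nonneg fun k _ => mul_nonneg (hz0 k).le (hD0 k x)
  have hN0 : ∀ x, 0 ≤ N x := mixLoss_nonneg hD0 hG0 fun k => (hz0 k).le
  have hNA : ∀ x, N x ≤ A x := mixLoss_le hD0 hG1 fun k => (hz0 k).le
  set B : X → ℝ := fun x => ∑ k, q k * D k x with hB
  have hB0 : ∀ x, 0 ≤ B x := fun x => Finset.sum_nonneg fun k _ => mul_nonneg (hq0 k) (hD0 k x)
  have hBA : ∀ x, B x ≤ 1 / η * A x := by
    intro x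
    refine (mix_le_sum hD0 hq0 hqsum x).trans ?_
    rw [hA, Finset.mul_sum]
    refine Finset.sum_le_sum fun k _ => ?_
    rw [← mul_assoc]
    refine le_mul_of_one_le_left (hD0 k x) ?_
    rw [one_div, inv_mul_eq_div, one_le_div hη]
    exact hz.1 k
  have hBi : Integrable B μ := integrable_finsetSum _ fun k _ => (hDi k).const_mul _
  have hJm : ∀ f : X → ℝ, Measurable f → (∀ x, 0 ≤ f x) → Integrable f μ →
      Integrable (fun x => f x * (N x / A x)) μ := fun f hf hf0 hfi =>
    hfi.mono' (by fun_prop) (ae_of_all _ fun x => by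
      rw [Real.norm_of_nonneg (mul_nonneg (hf0 x) (div_nonneg (hN0 x) (hA0 x)))]
      exact mul_le_of_le_one_right (hf0 x) (div_le_one_of_le₀ (hNA x) (hA0 x)))
  have hBJ : Integrable (fun x => B x * (N x / A x)) μ := hJm B (by fun_prop) hB0 hBi
  set J := ∫ x, B x * (N x / A x) ∂μ with hJ
  set Φ := mixPotential μ D G z with hΦ
  have hΦi := integrable_entropyPotential hD hG hD0 hG0 hG1 hDi (fun k => (hz0 k).le) hz.2
  have hstep : ∀ t : ℝ, 0 < t → t < 1 → (1 - t) / (1 - t + 1 / η * t) * J ≤ Φ := by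
    intro t ht ht1
    have h1t : 0 < 1 - t := sub_pos.2 ht1
    have hmem : (fun k => (1 - t) * z k + t * q k) ∈ truncatedSimplex p η := by
      refine ⟨fun k => ?_, ?_⟩
      · nlinarith [mul_le_mul_of_nonneg_left (hz.1 k) h1t.le,
          mul_le_mul_of_nonneg_left (hqz.1 k) ht.le]
      · rw [Finset.sum_add_distrib, ← Finset.mul_sum, ← Finset.mul_sum, hz.2, hqsum]; ring
    have hle : mixPotential μ D G (fun k => (1 - t) * z k + t * q k) ≤ Φ := hmax hmem
    have hi2 := integrable_entropyPotential hD hG hD0 hG0 hG1 hDi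
      (fun k => hη.le.trans (hmem.1 k)) hmem.2
    have hge : (1 - t) * Φ + t * (1 - t) / (1 - t + 1 / η * t) * J
        ≤ mixPotential μ D G (fun k => (1 - t) * z k + t * q k) := by
      rw [hΦ, hJ, mixPotential, mixPotential, ← integral_const_mul, ← integral_const_mul,
        ← integral_add (hΦi.const_mul _) (hBJ.const_mul _)]
      refine integral_mono ((hΦi.const_mul _).add (hBJ.const_mul _)) hi2 fun x => ?_
      have e1 : ∑ k, ((1 - t) * z k + t * q k) * D k x = (1 - t) * A x + t * B x := by
        simp only [hA, hB, Finset.mul_sum, ← Finset.sum_add_distrib]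
        exact Finset.sum_congr rfl fun k _ => by ring
      have e2 : ∑ k, ((1 - t) * z k + t * q k) * (D k x * G k x)
          = (1 - t) * N x + t * ∑ k, q k * (D k x * G k x) := by
        simp only [hN, Finset.mul_sum, ← Finset.sum_add_distrib]
        exact Finset.sum_congr rfl fun k _ => by ring
      simp only [e1, e2]
      change (1 - t) * entropyPotential (A x) (N x)
        + t * (1 - t) / (1 - t + 1 / η * t) * (B x * (N x / A x)) ≤ _
      have hN' := mixLoss_nonneg hD0 hG0 hq0 x
      have hNB' := mixLoss_le hD0 hG1 hq0 x
      rcases (hA0 x).eq_or_lt with h0 | h0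
      · have hN00 : N x = 0 := le_antisymm (h0 ▸ hNA x) (hN0 x)
        have h := entropyPotential_nonneg (D := (1 - t) * A x + t * B x)
          (N := (1 - t) * N x + t * ∑ k, q k * (D k x * G k x))
          (add_nonneg (mul_nonneg h1t.le (hN0 x)) (mul_nonneg ht.le hN'))
          (add_le_add (mul_le_mul_of_nonneg_left (hNA x) h1t.le)
            (mul_le_mul_of_nonneg_left hNB' ht.le))
        have h2 : entropyPotential (A x) (N x) = 0 := by simp [← h0, hN00, entropyPotential]
        rw [h2, hN00] at *
        simpa using h
      · have := entropyPotential_perturb h0 (hN0 x) (hNA x) hN' hNB' (hBA x) ht ht1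
        rwa [show B x * (N x / A x) = N x * B x / A x by ring]
    have : t * ((1 - t) / (1 - t + 1 / η * t) * J) ≤ t * Φ := by
      calc _ = t * (1 - t) / (1 - t + 1 / η * t) * J := by ring
        _ ≤ _ := by linarith
    exact le_of_mul_le_mul_left this ht
  have hJΦ : J ≤ Φ := by
    have hlim : Tendsto (fun t : ℝ => (1 - t) / (1 - t + 1 / η * t) * J) (𝓝[>] 0) (𝓝 J) := by
      have : ContinuousAt (fun t : ℝ => (1 - t) / (1 - t + 1 / η * t) * J) 0 := by
        refine ContinuousAt.mul (ContinuousAt.div (by fun_prop) (by fun_prop) (by simp))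
          continuousAt_const
      have h := this.tendsto
      simp only [sub_zero, mul_zero, add_zero, div_one, one_mul] at h
      exact h.mono_left nhdsWithin_le_nhds
    refine le_of_tendsto hlim ?_
    filter_upwards [Ioo_mem_nhdsGT (show (0 : ℝ) < 1 by norm_num)] with t ht
    exact hstep t ht.1 ht.2
  have hNi : Integrable N μ := integrable_finsetSum _ fun k _ => (hDGi k).const_mul _
  have hAi : Integrable A μ := integrable_finsetSum _ fun k _ => (hDi k).const_mul _
  have hΦle : Φ ≤ ε * (1 + Real.log (1 / ε)) := by
    have hlog : 0 ≤ Real.log (1 / ε) := Real.log_nonneg ((one_le_div hε).2 hε1)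
    have hNint : ∫ x, N x ∂μ ≤ ε := by
      rw [hN, integral_finsetSum _ fun k _ => (hDGi k).const_mul _]
      calc ∑ k, ∫ x, z k * (D k x * G k x) ∂μ ≤ ∑ k, z k * ε :=
            Finset.sum_le_sum fun k _ => by
              rw [integral_const_mul]
              exact mul_le_mul_of_nonneg_left (hDG k) (hz0 k).le
        _ = ε := by rw [← Finset.sum_mul, hz.2, one_mul]
    have hAint : ∫ x, A x ∂μ = 1 := by
      rw [hA, integral_finsetSum _ fun k _ => (hDi k).const_mul _]
      simp only [integral_const_mul, hD1, mul_one, hz.2]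
    calc Φ ≤ ∫ x, (N x * Real.log (1 / ε) + ε * A x) ∂μ :=
          integral_mono hΦi ((hNi.mul_const _).add (hAi.const_mul _)) fun x =>
            entropyPotential_le (hN0 x) (hNA x) hε
      _ = (∫ x, N x ∂μ) * Real.log (1 / ε) + ε * ∫ x, A x ∂μ := by
          rw [integral_add (hNi.mul_const _) (hAi.const_mul _), integral_mul_const,
            integral_const_mul]
      _ ≤ ε * Real.log (1 / ε) + ε * 1 := by rw [hAint]; gcongr
      _ = _ := by ring
  have hFJ : 8 / 9 * ∫ x, D i x * (N x / A x) ∂μ ≤ J := by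
    rw [hJ, ← integral_const_mul]
    refine integral_mono ((hJm _ (hD i) (hD0 i) (hDi i)).const_mul _) hBJ fun x => ?_
    have : 8 / 9 * D i x ≤ B x := by
      calc 8 / 9 * D i x ≤ q i * D i x :=
            mul_le_mul_of_nonneg_right (by simp only [hq, if_true]; linarith) (hD0 i x)
        _ ≤ _ := Finset.single_le_sum (f := fun k => q k * D k x)
            (fun k _ => mul_nonneg (hq0 k) (hD0 k x)) (Finset.mem_univ i)
    calc 8 / 9 * (D i x * (N x / A x)) = 8 / 9 * D i x * (N x / A x) := by ring
      _ ≤ _ := mul_le_mul_of_nonneg_right this (div_nonneg (hN0 x) (hA0 x))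
  linarith

end Potential

/-! ### Weights for the true densities -/

lemma sum_weights_le_one {p : ℕ} (a : Fin p → ℝ≥0) : ∑ k, a k / ∑ j, a j ≤ 1 := by
  rw [← Finset.sum_div]
  exact div_self_le_one _

lemma gmsa_le {X : Type*} {p : ℕ} {z : Fin p → ℝ≥0} {D G : Fin p → X → ℝ≥0} {M : ℝ≥0} {x : X}
    (hGM : ∀ k, G k x ≤ M) : gmsa z D G x ≤ M := by
  calc gmsa z D G x ≤ ∑ k, (z k * D k x / ∑ j, z j * D j x) * M :=
        Finset.sum_le_sum fun k _ => by rw [smul_eq_mul]; gcongr; exact hGM k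
    _ ≤ 1 * M := by rw [← Finset.sum_mul]; gcongr; exact sum_weights_le_one _
    _ = M := one_mul M

section Weights

variable {X : Type*} [MeasurableSpace X] {μ : Measure X} {p : ℕ}

lemma integrable_coe_of_lintegral_ne_top {f : X → ℝ≥0} (hf : Measurable f)
    (h : ∫⁻ x, (f x : ℝ≥0∞) ∂μ ≠ ∞) : Integrable (fun x => (f x : ℝ)) μ :=
  ⟨hf.coe_nnreal_real.aestronglyMeasurable, by
    simpa [HasFiniteIntegral, lt_top_iff_ne_top] using h⟩

lemma measurable_gmsa {D G : Fin p → X → ℝ≥0} (z : Fin p → ℝ≥0) (hD : ∀ k, Measurable (D k))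
    (hG : ∀ k, Measurable (G k)) : Measurable (gmsa z D G) := by
  unfold gmsa
  simp only [smul_eq_mul]
  fun_prop

/-- Weights with full support whose distribution-weighted combination has, on every source domain,
the same loss bound `ε` up to a logarithmic factor. -/
lemma exists_weights (hp : 0 < p) {D G : Fin p → X → ℝ≥0} (hD : ∀ k, Measurable (D k))
    (hG : ∀ k, Measurable (G k)) (hD1 : ∀ k, ∫⁻ x, (D k x : ℝ≥0∞) ∂μ = 1)
    {ε M : ℝ≥0} (hε : 0 < ε) (hεM : ε ≤ M) (hGM : ∀ k x, G k x ≤ M)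
    (hDG : ∀ k, ∫⁻ x, (D k x * G k x : ℝ≥0) ∂μ ≤ ε) :
    ∃ z : Fin p → ℝ≥0, (∀ k, 0 < z k) ∧ ∑ k, z k = 1 ∧ ∀ i,
      ∫⁻ x, (D i x * gmsa z D G x : ℝ≥0) ∂μ
        ≤ ENNReal.ofReal (9 / 8 * (ε * (1 + Real.log (M / ε)))) := by
  have hM : (0 : ℝ) < M := by exact_mod_cast hε.trans_le hεM
  have hε' : (0 : ℝ) < ε := by exact_mod_cast hε
  have hDi : ∀ k, Integrable (fun x => (D k x : ℝ)) μ := fun k =>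
    integrable_coe_of_lintegral_ne_top (hD k) (by simp [hD1])
  have hDGi : ∀ k, Integrable (fun x => ((D k x * G k x : ℝ≥0) : ℝ)) μ := fun k =>
    integrable_coe_of_lintegral_ne_top ((hD k).mul (hG k))
      (ne_top_of_le_ne_top ENNReal.coe_ne_top (hDG k))
  obtain ⟨z, hz0, hz1, hz⟩ := exists_weights_of_le_one (μ := μ) (D := fun k x => (D k x : ℝ))
    (G := fun k x => (G k x : ℝ) / M) (ε := ε / M) hp (fun k => (hD k).coe_nnreal_real)
    (fun k => (hG k).coe_nnreal_real.div_const _) (fun k x => (D k x).2)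
    (fun k x => div_nonneg (G k x).2 hM.le)
    (fun k x => div_le_one_of_le₀ (by exact_mod_cast hGM k x) hM.le) hDi
    (fun k => by
      have := lintegral_coe_eq_integral _ (hDi k)
      rw [hD1] at this
      simpa using this.symm)
    (by positivity) (div_le_one_of_le₀ (by exact_mod_cast hεM) hM.le)
    (fun k => by
      have h := hDG k
      rw [lintegral_coe_eq_integral _ (hDGi k)] at h
      have h2 : ∫ x, ((D k x * G k x : ℝ≥0) : ℝ) ∂μ ≤ ε := by
        rwa [← ENNReal.ofReal_coe_nnreal, ENNReal.ofReal_le_ofReal_iff ε.coe_nonneg] at h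
      simp only [← mul_div_assoc, integral_div]
      gcongr
      simpa using h2)
  lift z to Fin p → ℝ≥0 using fun k => (hz0 k).le
  refine ⟨z, fun k => by exact_mod_cast hz0 k, NNReal.eq (by simpa using hz1), fun i => ?_⟩
  have hmeas : Measurable (fun x => D i x * gmsa z D G x) := (hD i).mul (measurable_gmsa z hD hG)
  have hint : Integrable (fun x => ((D i x * gmsa z D G x : ℝ≥0) : ℝ)) μ :=
    ((hDi i).mul_const (M : ℝ)).mono' hmeas.coe_nnreal_real.aestronglyMeasurable
      (ae_of_all _ fun x => by
        rw [Real.norm_of_nonneg (NNReal.coe_nonneg _)]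
        exact_mod_cast mul_le_mul_right (gmsa_le fun k => hGM k x) _)
  rw [lintegral_coe_eq_integral _ hint]
  refine ENNReal.ofReal_le_ofReal ?_
  have heq : ∀ x, ((D i x * gmsa z D G x : ℝ≥0) : ℝ) = M * (D i x *
      ((∑ k, (z k : ℝ) * (D k x * (G k x / M))) / ∑ k, (z k : ℝ) * D k x)) := by
    intro x
    simp only [gmsa, NNReal.coe_mul, NNReal.coe_sum, NNReal.coe_div, smul_eq_mul, Finset.sum_div,
      Finset.mul_sum]
    exact Finset.sum_congr rfl fun k _ => by field_simp
  simp only [heq, integral_const_mul]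
  calc (M : ℝ) * _ ≤ M * (9 / 8 * (ε / M * (1 + Real.log (1 / (ε / M))))) := by
        gcongr; exact hz i
    _ = _ := by rw [one_div_div]; field_simp

end Weights

/-! ### Rényi divergences of infinite order and the kernel -/

section Renyi

variable {X : Type*} [MeasurableSpace X] {μ : Measure X} {P Q : X → ℝ≥0}

lemma ae_le_renyiExpTop_mul (hP : Measurable P) (hQ : Measurable Q)
    (hP1 : ∫⁻ x, (P x : ℝ≥0∞) ∂μ = 1) (hfin : renyiExpTop μ P Q ≠ ∞) :
    ∀ᵐ x ∂μ, (P x : ℝ≥0∞) ≤ renyiExpTop μ P Q * Q x := by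
  have h := ae_le_essSup (f := fun x => (P x : ℝ≥0∞) / (Q x : ℝ≥0∞)) (μ := law μ P)
  rw [← renyiExpTop_eq_essSup μ P Q hP hQ hP1, law, ae_withDensity_iff hP.coe_nnreal_ennreal] at h
  filter_upwards [h] with x hx
  rcases eq_or_ne (P x) 0 with h0 | h0
  · simp [h0]
  · exact (ENNReal.div_le_iff_le_mul (Or.inr hfin) (Or.inl ENNReal.coe_ne_top)).1
      (hx (by exact_mod_cast h0))

lemma renyiExpTop_le (hP : Measurable P) (hQ : Measurable Q)
    (hP1 : ∫⁻ x, (P x : ℝ≥0∞) ∂μ = 1) {A : ℝ≥0∞} (h : ∀ᵐ x ∂μ, (P x : ℝ≥0∞) ≤ A * Q x) :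
    renyiExpTop μ P Q ≤ A := by
  rw [renyiExpTop_eq_essSup μ P Q hP hQ hP1]
  refine essSup_le_of_ae_le _ ?_
  filter_upwards [(withDensity_absolutelyContinuous μ _).ae_le h] with x hx
  exact ENNReal.div_le_of_le_mul hx

lemma one_le_renyiExpTop (hP : Measurable P) (hQ : Measurable Q)
    (hP1 : ∫⁻ x, (P x : ℝ≥0∞) ∂μ = 1) (hQ1 : ∫⁻ x, (Q x : ℝ≥0∞) ∂μ = 1) :
    1 ≤ renyiExpTop μ P Q := by
  by_cases hfin : renyiExpTop μ P Q = ∞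
  · simp [hfin]
  calc (1 : ℝ≥0∞) = ∫⁻ x, (P x : ℝ≥0∞) ∂μ := hP1.symm
    _ ≤ ∫⁻ x, renyiExpTop μ P Q * Q x ∂μ :=
        lintegral_mono_ae (ae_le_renyiExpTop_mul hP hQ hP1 hfin)
    _ = _ := by rw [lintegral_const_mul _ hQ.coe_nnreal_ennreal, hQ1, mul_one]

lemma lintegral_law (hP : Measurable P) {f : X → ℝ≥0∞} (hf : Measurable f) :
    ∫⁻ x, f x ∂(law μ P) = ∫⁻ x, P x * f x ∂μ := by
  rw [law, lintegral_withDensity_eq_lintegral_mul _ hP.coe_nnreal_ennreal hf]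
  rfl

lemma isProbabilityMeasure_law (hP1 : ∫⁻ x, (P x : ℝ≥0∞) ∂μ = 1) :
    IsProbabilityMeasure (law μ P) := ⟨by simp [law, hP1]⟩

end Renyi

lemma kernel_le_kappa_mul {X : Type*} {K : X → X → ℝ≥0} (hKpos : ∀ x x', 0 < K x x')
    (u x x' : X) :
    (K u x : ℝ≥0∞) ≤ kappa K * K u x' := by
  have h : (K u x : ℝ≥0∞) / K u x' ≤ kappa K :=
    le_iSup_of_le u (le_iSup_of_le x (le_iSup_of_le x' le_rfl))
  exact (ENNReal.div_le_iff (by exact_mod_cast (hKpos u x').ne') ENNReal.coe_ne_top).1 h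

lemma one_le_kappa {X : Type*} [Nonempty X] {K : X → X → ℝ≥0}
    (hKpos : ∀ x x', 0 < K x x') : 1 ≤ kappa K := by
  obtain ⟨x⟩ := ‹Nonempty X›
  refine le_iSup_of_le x (le_iSup_of_le x (le_iSup_of_le x ?_))
  rw [ENNReal.div_self (by exact_mod_cast (hKpos x x).ne') ENNReal.coe_ne_top]

section Kernel

variable {X : Type*} [MeasurableSpace X] {μ : Measure X} {D : X → ℝ≥0} {K : X → X → ℝ≥0}

lemma measurable_renyiExpTop_left [SFinite μ] (hD : Measurable D) (hK : Measurable (uncurry K))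
    (hK1 : ∀ x', ∫⁻ x, (K x x' : ℝ≥0∞) ∂μ = 1) :
    Measurable (fun x => renyiExpTop μ (fun u => K u x) D) := by
  have hKx : ∀ x, Measurable (fun u => K u x) := fun x =>
    hK.comp (measurable_id.prodMk measurable_const)
  refine measurable_of_tendsto_metrizable (f := fun (n : ℕ) x => renyiExp μ n (fun u => K u x) D)
    (fun n => ?_) (tendsto_pi_nhds.2 fun x => ?_)
  · refine Measurable.pow_const (Measurable.lintegral_prod_left' (f := fun q : X × X =>
      (K q.1 q.2 : ℝ≥0∞) * ((K q.1 q.2 : ℝ≥0∞) / (D q.1 : ℝ≥0∞)) ^ ((n : ℝ) - 1)) ?_) _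
    have h1 : Measurable fun q : X × X => (K q.1 q.2 : ℝ≥0∞) := hK.coe_nnreal_ennreal
    exact h1.mul ((h1.div (hD.comp measurable_fst).coe_nnreal_ennreal).pow_const _)
  · rw [renyiExpTop_eq_essSup μ _ D (hKx x) hD (hK1 x)]
    exact (tendsto_renyiExp μ _ D (hKx x) hD (hK1 x)).comp tendsto_natCast_atTop_atTop

lemma measurable_renyiExpTop_right [SFinite μ] (hD : Measurable D) (hK : Measurable (uncurry K))
    (hD1 : ∫⁻ x, (D x : ℝ≥0∞) ∂μ = 1) :
    Measurable (fun x => renyiExpTop μ D (fun u => K u x)) := by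
  have hKx : ∀ x, Measurable (fun u => K u x) := fun x =>
    hK.comp (measurable_id.prodMk measurable_const)
  refine measurable_of_tendsto_metrizable (f := fun (n : ℕ) x => renyiExp μ n D (fun u => K u x))
    (fun n => ?_) (tendsto_pi_nhds.2 fun x => ?_)
  · refine Measurable.pow_const (Measurable.lintegral_prod_left' (f := fun q : X × X =>
      (D q.1 : ℝ≥0∞) * ((D q.1 : ℝ≥0∞) / (K q.1 q.2 : ℝ≥0∞)) ^ ((n : ℝ) - 1)) ?_) _
    have h1 : Measurable fun q : X × X => (K q.1 q.2 : ℝ≥0∞) := hK.coe_nnreal_ennreal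
    have h2 : Measurable fun q : X × X => (D q.1 : ℝ≥0∞) :=
      (hD.comp measurable_fst).coe_nnreal_ennreal
    exact h2.mul ((h2.div h1).pow_const _)
  · rw [renyiExpTop_eq_essSup μ D _ hD (hKx x) hD1]
    exact (tendsto_renyiExp μ D _ hD (hKx x) hD1).comp tendsto_natCast_atTop_atTop

lemma renyiExpTop_left_le_kappa_mul (hD : Measurable D) (hK : Measurable (uncurry K))
    (hKpos : ∀ x x', 0 < K x x') (hK1 : ∀ x', ∫⁻ x, (K x x' : ℝ≥0∞) ∂μ = 1) (x x' : X) :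
    renyiExpTop μ (fun u => K u x) D ≤ kappa K * renyiExpTop μ (fun u => K u x') D := by
  have : Nonempty X := ⟨x⟩
  have hKx : ∀ x, Measurable (fun u => K u x) := fun x =>
    hK.comp (measurable_id.prodMk measurable_const)
  by_cases hfin : renyiExpTop μ (fun u => K u x') D = ∞
  · rw [hfin, ENNReal.mul_top (zero_lt_one.trans_le (one_le_kappa hKpos)).ne']
    exact le_top
  refine renyiExpTop_le (hKx x) hD (hK1 x) ?_
  filter_upwards [ae_le_renyiExpTop_mul (hKx x') hD (hK1 x') hfin] with u hu
  calc (K u x : ℝ≥0∞) ≤ kappa K * K u x' := kernel_le_kappa_mul hKpos u x x'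
    _ ≤ _ := by rw [mul_assoc]; gcongr

lemma renyiExpTop_right_le_kappa_mul (hD : Measurable D) (hK : Measurable (uncurry K))
    (hKpos : ∀ x x', 0 < K x x') (hD1 : ∫⁻ x, (D x : ℝ≥0∞) ∂μ = 1) (x x' : X) :
    renyiExpTop μ D (fun u => K u x) ≤ kappa K * renyiExpTop μ D (fun u => K u x') := by
  have : Nonempty X := ⟨x⟩
  have hKx : ∀ x, Measurable (fun u => K u x) := fun x =>
    hK.comp (measurable_id.prodMk measurable_const)
  by_cases hfin : renyiExpTop μ D (fun u => K u x') = ∞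
  · rw [hfin, ENNReal.mul_top (zero_lt_one.trans_le (one_le_kappa hKpos)).ne']
    exact le_top
  refine renyiExpTop_le hD (hKx x) hD1 ?_
  filter_upwards [ae_le_renyiExpTop_mul hD (hKx x') hD1 hfin] with u hu
  calc (D u : ℝ≥0∞) ≤ renyiExpTop μ D (fun u => K u x') * K u x' := hu
    _ ≤ renyiExpTop μ D (fun u => K u x') * (kappa K * K u x) := by
        gcongr; exact kernel_le_kappa_mul hKpos u x' x
    _ = _ := by ring

end Kernel

/-! ### Concentration of averages over labeled sample points -/

section Concentration

/-- Chernoff's bound for a sum of independent copies of `f`. -/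
lemma pi_sum_nonneg_le {Ω : Type*} [MeasurableSpace Ω] (ν : Measure Ω) [IsProbabilityMeasure ν]
    (m : ℕ) {f : Ω → ℝ} (hf : Integrable (fun ω => Real.exp (f ω)) ν) :
    (Measure.pi (fun _ : Fin m => ν)).real {S | 0 ≤ ∑ i, f (S i)}
      ≤ (∫ ω, Real.exp (f ω) ∂ν) ^ m := by
  have hint : Integrable (fun S : Fin m → Ω => ∏ i, Real.exp (f (S i)))
      (Measure.pi (fun _ : Fin m => ν)) := Integrable.fintype_prod (fun _ => hf)
  have h := mul_meas_ge_le_integral_of_nonneg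
    (ae_of_all _ fun S => Finset.prod_nonneg fun i _ => (Real.exp_pos (f (S i))).le) hint 1
  rw [one_mul, integral_fintype_prod_eq_pow (fun ω => Real.exp (f ω)), Fintype.card_fin] at h
  convert h using 4 with S
  rw [← Real.exp_sum, Real.one_le_exp_iff]

variable {X : Type*} [MeasurableSpace X] {μ : Measure X} {p : ℕ} {D : Fin p → X → ℝ≥0}

lemma isProbabilityMeasure_labeledLaw (hp : 0 < p) (hD1 : ∀ k, ∫⁻ x, (D k x : ℝ≥0∞) ∂μ = 1) :
    IsProbabilityMeasure (labeledLaw μ D) := by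
  constructor
  have h : ∀ k : Fin p, ((law μ (D k)).map (fun x => (x, k))) Set.univ = 1 := by
    intro k
    have := isProbabilityMeasure_law (hD1 k)
    rw [Measure.map_apply (by fun_prop) MeasurableSet.univ]
    simp
  have hp' : (p : ℝ≥0) ≠ 0 := by exact_mod_cast hp.ne'
  simp only [labeledLaw, Measure.coe_finsetSum, Finset.sum_apply, Measure.smul_apply, h,
    Finset.sum_const, Finset.card_univ, Fintype.card_fin, nsmul_eq_mul]
  rw [ENNReal.smul_def, smul_eq_mul, mul_one, ENNReal.coe_inv hp']
  exact ENNReal.mul_inv_cancel (by exact_mod_cast hp.ne') (by simp)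

lemma integral_labeledLaw (f : X × Fin p → ℝ) (hf : Measurable f)
    (hfi : ∀ k, Integrable (fun x => f (x, k)) (law μ (D k))) :
    Integrable f (labeledLaw μ D) ∧
      ∫ q, f q ∂(labeledLaw μ D) = ∑ k, (p : ℝ)⁻¹ * ∫ x, f (x, k) ∂(law μ (D k)) := by
  have h1 : ∀ k : Fin p, Integrable f ((p : ℝ≥0)⁻¹ • (law μ (D k)).map (fun x => (x, k))) := by
    intro k
    refine Integrable.smul_measure_nnreal ?_
    exact (integrable_map_measure hf.aestronglyMeasurable (by fun_prop)).2 (hfi k)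
  refine ⟨integrable_finsetSum_measure.2 fun k _ => h1 k, ?_⟩
  rw [labeledLaw, integral_finsetSum_measure fun k _ => h1 k]
  refine Finset.sum_congr rfl fun k _ => ?_
  rw [integral_smul_nnreal_measure, integral_map (by fun_prop) hf.aestronglyMeasurable]
  rfl

/-- Chernoff's bound for the sum of `f` over the sample points labeled `k`, whose number is random
with mean `m / p`. The event contains the samples without a point labeled `k`. -/
lemma sampleLaw_sum_nonneg_le (hp : 0 < p) (hD1 : ∀ k, ∫⁻ x, (D k x : ℝ≥0∞) ∂μ = 1) (m : ℕ)
    (k : Fin p) {f : X → ℝ} (hf : Measurable f) {ρ : ℝ}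
    (hfi : Integrable (fun x => Real.exp (f x)) (law μ (D k)))
    (hρ : ∫ x, Real.exp (f x) ∂(law μ (D k)) ≤ ρ) :
    (sampleLaw μ D m).real {S | 0 ≤ ∑ i with (S i).2 = k, f (S i).1}
      ≤ Real.exp (-(m / p * (1 - ρ))) := by
  have := isProbabilityMeasure_labeledLaw hp hD1
  have hlaw : ∀ j, IsProbabilityMeasure (law μ (D j)) := fun j => isProbabilityMeasure_law (hD1 j)
  have hp' : (0 : ℝ) < p := by exact_mod_cast hp
  set F : X × Fin p → ℝ := fun q => if q.2 = k then f q.1 else 0 with hF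
  have hFm : Measurable F :=
    Measurable.ite (measurable_snd (measurableSet_singleton k)) (hf.comp measurable_fst)
      measurable_const
  have hFi : ∀ j, Integrable (fun x => Real.exp (F (x, j))) (law μ (D j)) := by
    intro j
    by_cases hj : j = k
    · subst hj; simpa [hF] using hfi
    · simp [hF, hj]
  obtain ⟨h1, h2⟩ := integral_labeledLaw (fun q => Real.exp (F q)) hFm.exp hFi
  have h3 : ∫ q, Real.exp (F q) ∂(labeledLaw μ D) ≤ Real.exp (-((p : ℝ)⁻¹ * (1 - ρ))) := by
    rw [h2, ← Finset.add_sum_erase _ _ (Finset.mem_univ k)]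
    have h4 : ∑ j ∈ Finset.univ.erase k, (p : ℝ)⁻¹ * ∫ x, Real.exp (F (x, j)) ∂(law μ (D j))
        = 1 - (p : ℝ)⁻¹ := by
      rw [Finset.sum_congr rfl (g := fun _ => (p : ℝ)⁻¹)]
      · rw [Finset.sum_const, Finset.card_erase_of_mem (Finset.mem_univ k), Finset.card_univ,
          Fintype.card_fin, nsmul_eq_mul, Nat.cast_pred hp]
        field_simp
      · intro j hj
        simp [hF, Finset.ne_of_mem_erase hj]
    rw [h4]
    have h5 : ∫ x, Real.exp (F (x, k)) ∂(law μ (D k)) ≤ ρ := by simpa [hF] using hρ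
    have h6 := Real.add_one_le_exp (-((p : ℝ)⁻¹ * (1 - ρ)))
    have h7 : (p : ℝ)⁻¹ * ∫ x, Real.exp (F (x, k)) ∂(law μ (D k)) ≤ (p : ℝ)⁻¹ * ρ := by gcongr
    linarith
  have h8 := pi_sum_nonneg_le (labeledLaw μ D) m h1
  calc (sampleLaw μ D m).real {S | 0 ≤ ∑ i with (S i).2 = k, f (S i).1}
      = (Measure.pi (fun _ : Fin m => labeledLaw μ D)).real {S | 0 ≤ ∑ i, F (S i)} := by
        simp only [hF, Finset.sum_filter, sampleLaw]
    _ ≤ _ := h8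
    _ ≤ Real.exp (-((p : ℝ)⁻¹ * (1 - ρ))) ^ m :=
        pow_le_pow_left₀ (integral_nonneg fun _ => (Real.exp_pos _).le) h3 m
    _ = _ := by rw [← Real.exp_nat_mul]; congr 1; field_simp

/-- The average of `g` over the sample points labeled `k` exceeds `(1 + τ) * d` with exponentially
small probability if `g` has mean at most `d` and values in `[0, c * d]`. -/
lemma sampleLaw_average_le (hp : 0 < p) (hD1 : ∀ k, ∫⁻ x, (D k x : ℝ≥0∞) ∂μ = 1) (m : ℕ)
    (k : Fin p) {g : X → ℝ} (hg : Measurable g) {c d τ : ℝ} (hc : 0 < c) (hd : 0 < d) (hτ : 0 < τ)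
    (hg0 : ∀ x, 0 ≤ g x) (hgc : ∀ x, g x ≤ c * d) (hgd : ∫ x, g x ∂(law μ (D k)) ≤ d) :
    (sampleLaw μ D m).real {S | 0 ≤ ∑ i with (S i).2 = k, (g (S i).1 - (1 + τ) * d)}
      ≤ Real.exp (-(m / p * (1 - Real.exp (-(2 * τ ^ 2 / c ^ 2))))) := by
  have := isProbabilityMeasure_law (hD1 k)
  -- the minimizer of the exponent `c ^ 2 * d ^ 2 * s ^ 2 / 8 - s * τ * d`
  set s : ℝ := 4 * τ / (c ^ 2 * d) with hs
  have hs0 : 0 < s := by positivity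
  set a := ∫ x, g x ∂(law μ (D k)) with ha
  have hH := hasSubgaussianMGF_of_mem_Icc (μ := law μ (D k)) (a := 0) (b := c * d) hg.aemeasurable
    (ae_of_all _ fun x => ⟨hg0 x, hgc x⟩)
  have hi : Integrable (fun x => Real.exp (s * (g x - (1 + τ) * d))) (law μ (D k)) := by
    have h := (hH.integrable_exp_mul s).mul_const (Real.exp (s * (a - (1 + τ) * d)))
    refine h.congr (ae_of_all _ fun x => ?_)
    simp only
    rw [← Real.exp_add]
    congr 1
    ring
  have h := sampleLaw_sum_nonneg_le hp hD1 m k (f := fun x => s * (g x - (1 + τ) * d))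
    (by fun_prop) hi (ρ := Real.exp (-(2 * τ ^ 2 / c ^ 2))) ?_
  · simpa only [← Finset.mul_sum, mul_nonneg_iff_of_pos_left hs0] using h
  · have h1 := hH.mgf_le s
    rw [mgf] at h1
    have h2 : ∀ x, Real.exp (s * (g x - (1 + τ) * d))
        = Real.exp (s * (g x - a)) * Real.exp (s * (a - (1 + τ) * d)) := fun x => by
      rw [← Real.exp_add]; congr 1; ring
    simp only [h2, integral_mul_const]
    refine (mul_le_mul_of_nonneg_right h1 (Real.exp_pos _).le).trans ?_
    rw [← Real.exp_add, Real.exp_le_exp]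
    have h3 : ((((‖c * d - 0‖₊ / 2) ^ 2 : ℝ≥0) : ℝ)) = (c * d / 2) ^ 2 := by
      simp [abs_of_pos hc, abs_of_pos hd]
    rw [h3]
    have h4 : s * (a - (1 + τ) * d) ≤ s * (- (τ * d)) := by
      apply mul_le_mul_of_nonneg_left _ hs0.le; linarith
    have h5 : (c * d / 2) ^ 2 * s ^ 2 / 2 + s * (-(τ * d)) = -(2 * τ ^ 2 / c ^ 2) := by
      rw [hs]; field_simp; ring
    linarith

end Concentration

/-! ### Comparison of densities, kernel density estimates and combinations -/

section Ratio

variable {X : Type*} [MeasurableSpace X] {μ : Measure X}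

/-- If `f ≤ a x * b x * h` almost everywhere, for every point `x`, and the means of `a` under `f`
and of `b` under `h` are close to `1`, then the density ratio `f / h` is close to `1`. -/
lemma ae_le_sq_mul_of_forall_ae_le {f h a b : X → ℝ≥0} (hf : Measurable f) (hh : Measurable h)
    (ha : Measurable a) (hb : Measurable b) (hf1 : ∫⁻ x, (f x : ℝ≥0∞) ∂μ = 1)
    (hh1 : ∫⁻ x, (h x : ℝ≥0∞) ∂μ = 1) (hab : ∀ x, ∀ᵐ u ∂μ, f u ≤ a x * b x * h u)
    (hb1 : ∀ x, 1 ≤ b x) {d d' : ℝ≥0} (hd : 1 ≤ d) (hd' : 1 ≤ d')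
    (hfa : ∫⁻ x, (f x * a x : ℝ≥0) ∂μ ≤ d') (hhb : ∫⁻ x, (h x * b x : ℝ≥0) ∂μ ≤ d)
    (hdd : d * d' ≤ 3 / 2) :
    ∀ᵐ u ∂μ, f u ≤ (d * d') ^ 2 * h u := by
  have hne : Nonempty X := by
    by_contra hX
    rw [not_nonempty_iff] at hX
    simp [Measure.eq_zero_of_isEmpty μ] at hf1
  -- the optimal constant `c` in `f ≤ c * h`
  have hcle : ∀ x, essSup (fun u => (f u : ℝ≥0∞) / h u) μ ≤ (a x * b x : ℝ≥0) := fun x => by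
    refine essSup_le_of_ae_le _ ?_
    filter_upwards [hab x] with u hu
    exact ENNReal.div_le_of_le_mul (by exact_mod_cast hu)
  have hfm : Measurable fun x => (f x : ℝ≥0∞) := hf.coe_nnreal_ennreal
  have hhm : Measurable fun x => (h x : ℝ≥0∞) := hh.coe_nnreal_ennreal
  have hfam : Measurable fun x => ((f x * a x : ℝ≥0) : ℝ≥0∞) := (hf.mul ha).coe_nnreal_ennreal
  have hfbm : Measurable fun x => ((f x * b x : ℝ≥0) : ℝ≥0∞) := (hf.mul hb).coe_nnreal_ennreal
  have hhbm : Measurable fun x => ((h x * b x : ℝ≥0) : ℝ≥0∞) := (hh.mul hb).coe_nnreal_ennreal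
  obtain ⟨x₀⟩ := hne
  have hctop : essSup (fun u => (f u : ℝ≥0∞) / h u) μ ≠ ∞ :=
    ne_top_of_le_ne_top ENNReal.coe_ne_top (hcle x₀)
  have hfc : ∀ᵐ u ∂μ, (f u : ℝ≥0∞) ≤ essSup (fun u => (f u : ℝ≥0∞) / h u) μ * h u := by
    filter_upwards [ae_le_essSup (f := fun u => (f u : ℝ≥0∞) / h u) (μ := μ)] with u hu
    exact (ENNReal.div_le_iff_le_mul (Or.inr hctop) (Or.inl ENNReal.coe_ne_top)).1 hu
  lift essSup (fun u => (f u : ℝ≥0∞) / h u) μ to ℝ≥0 using hctop with c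
  have hcle : ∀ x, c ≤ a x * b x := fun x => by exact_mod_cast hcle x
  have hfc : ∀ᵐ u ∂μ, f u ≤ c * h u := by
    filter_upwards [hfc] with u hu
    exact_mod_cast hu
  -- the mean of `b` under `f`, compared with its mean under `h`
  have hI : ∫⁻ x, (f x * b x : ℝ≥0) ∂μ + c ≤ c * d + 1 := by
    calc ∫⁻ x, (f x * b x : ℝ≥0) ∂μ + c
        = ∫⁻ x, ((f x * b x : ℝ≥0) + c * (h x : ℝ≥0∞)) ∂μ := by
          rw [lintegral_add_left hfbm,
            lintegral_const_mul _ hhm, hh1, mul_one]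
      _ ≤ ∫⁻ x, (c * (h x * b x : ℝ≥0) + (f x : ℝ≥0∞)) ∂μ := by
          refine lintegral_mono_ae ?_
          filter_upwards [hfc] with x hx
          norm_cast
          have h1 : (f x : ℝ) ≤ c * h x := by exact_mod_cast hx
          have h2 : (1 : ℝ) ≤ b x := by exact_mod_cast hb1 x
          rw [← NNReal.coe_le_coe]
          push_cast
          nlinarith [mul_nonneg (sub_nonneg.2 h1) (sub_nonneg.2 h2)]
      _ = c * ∫⁻ x, (h x * b x : ℝ≥0) ∂μ + 1 := by
          rw [lintegral_add_right _ hfm,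
            lintegral_const_mul _ hhbm, hf1]
      _ ≤ _ := by gcongr
  have hItop : ∫⁻ x, (f x * b x : ℝ≥0) ∂μ ≠ ∞ := by
    refine ne_top_of_le_ne_top ?_ (le_self_add.trans hI)
    exact_mod_cast ENNReal.coe_ne_top (r := c * d + 1)
  -- the arithmetic-geometric mean inequality for `c * a x` and `d' ^ 2 * b x`
  have hAG : (2 * c * d' : ℝ≥0) ≤ c * d' + d' ^ 2 * ∫⁻ x, (f x * b x : ℝ≥0) ∂μ := by
    calc ((2 * c * d' : ℝ≥0) : ℝ≥0∞) = ∫⁻ x, (2 * c * d' : ℝ≥0) * (f x : ℝ≥0∞) ∂μ := by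
          rw [lintegral_const_mul _ hfm, hf1, mul_one]
      _ ≤ ∫⁻ x, ((c : ℝ≥0∞) * (f x * a x : ℝ≥0) + (d' : ℝ≥0∞) ^ 2 * (f x * b x : ℝ≥0)) ∂μ := by
          refine lintegral_mono fun x => ?_
          norm_cast
          have h1 : (c : ℝ) ≤ a x * b x := by exact_mod_cast hcle x
          rw [ENNReal.coe_le_coe, ← NNReal.coe_le_coe]
          push_cast
          have h3 : (2 * c * d' : ℝ) ≤ c * a x + d' ^ 2 * b x := by
            have h4 : (2 * c * d' : ℝ) ^ 2 ≤ (c * a x + d' ^ 2 * b x) ^ 2 := by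
              have : (c : ℝ) * (c * d' ^ 2) ≤ c * ((a x * b x) * d' ^ 2) := by gcongr
              nlinarith [sq_nonneg ((c : ℝ) * a x - d' ^ 2 * b x)]
            exact (pow_le_pow_iff_left₀ (by positivity) (by positivity) two_ne_zero).1 h4
          calc (2 * c * d' : ℝ) * f x ≤ (c * a x + d' ^ 2 * b x) * f x := by gcongr
            _ = _ := by ring
      _ = c * ∫⁻ x, (f x * a x : ℝ≥0) ∂μ + d' ^ 2 * ∫⁻ x, (f x * b x : ℝ≥0) ∂μ := by
          rw [lintegral_add_left (hfam.const_mul _),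
            lintegral_const_mul _ hfam,
            lintegral_const_mul _ hfbm]
      _ ≤ _ := by gcongr
  lift ∫⁻ x, (f x * b x : ℝ≥0) ∂μ to ℝ≥0 using hItop with I
  have hI : (I : ℝ) + c ≤ c * d + 1 := by exact_mod_cast hI
  have hAG : (2 * c * d' : ℝ) ≤ c * d' + d' ^ 2 * I := by exact_mod_cast hAG
  have hd1 : (1 : ℝ) ≤ d := by exact_mod_cast hd
  have hd1' : (1 : ℝ) ≤ d' := by exact_mod_cast hd'
  have hdd : (d : ℝ) * d' ≤ 3 / 2 := by exact_mod_cast hdd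
  have hc : (c : ℝ) ≤ (d * d') ^ 2 := by
    have h1 : (c : ℝ) ≤ d' * I := by
      refine le_of_mul_le_mul_left ?_ (by linarith : (0 : ℝ) < d')
      linarith
    have h2 : (d' : ℝ) * I ≤ d' * (c * d + 1 - c) := by gcongr; linarith
    set P : ℝ := d * d' with hP
    have hP1 : 1 ≤ P := by nlinarith
    have h3 : c * (1 + d' - P) ≤ d' := by nlinarith
    have h4 : (d' : ℝ) ≤ P ^ 2 * (1 + d' - P) := by
      have : 0 ≤ (P - 1) * (d' * (P + 1) - P ^ 2) :=
        mul_nonneg (by linarith) (by nlinarith)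
      linarith
    exact le_of_mul_le_mul_right (h3.trans h4) (by linarith)
  filter_upwards [hfc] with u hu
  exact hu.trans (by gcongr; exact_mod_cast hc)

end Ratio

section Comparison

variable {X : Type*} {p : ℕ}

lemma gmsa_le_mul_gmsa {z : Fin p → ℝ≥0} {D D' G : Fin p → X → ℝ≥0} {a b : ℝ≥0} {x : X}
    (h1 : ∀ k, D' k x ≤ a * D k x) (h2 : ∀ k, D k x ≤ b * D' k x) :
    gmsa z D' G x ≤ a * b * gmsa z D G x := by
  simp only [gmsa, smul_eq_mul, Finset.mul_sum]
  refine Finset.sum_le_sum fun k _ => ?_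
  rw [← mul_assoc]
  gcongr
  set S := ∑ j, z j * D j x with hS
  set S' := ∑ j, z j * D' j x with hS'
  have hSS : S ≤ b * S' := by
    rw [hS, hS', Finset.mul_sum]
    exact Finset.sum_le_sum fun j _ => by
      calc z j * D j x ≤ z j * (b * D' j x) := by gcongr; exact h2 j
        _ = _ := by ring
  have hk : z k * D' k x ≤ a * (z k * D k x) := by
    calc z k * D' k x ≤ z k * (a * D k x) := by gcongr; exact h1 k
      _ = _ := by ring
  rcases eq_or_ne S 0 with h0 | h0
  · have : z k * D k x = 0 :=
      (Finset.sum_eq_zero_iff.1 (hS ▸ h0)) k (Finset.mem_univ k)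
    rw [this, mul_zero, nonpos_iff_eq_zero] at hk
    simp [hk]
  have h0' : S' ≠ 0 := by
    rintro h
    simp [h] at hSS
    exact h0 hSS
  rw [div_le_iff₀ (pos_iff_ne_zero.2 h0')]
  calc z k * D' k x ≤ a * (z k * D k x) := hk
    _ = a * (z k * D k x / S) * S := by field_simp
    _ ≤ a * (z k * D k x / S) * (b * S') := by gcongr
    _ = _ := by ring

lemma mul_gmsa_le_of_le_mul {z : Fin p → ℝ≥0} (hz : ∑ k, z k = 1) {D G : Fin p → X → ℝ≥0}
    {c : ℝ≥0} {x : X} {i : Fin p} (h : ∀ j, D i x ≤ c * D j x) :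
    D i x * gmsa z D G x ≤ c * ∑ k, z k * (D k x * G k x) := by
  have h1 : D i x ≤ c * ∑ k, z k * D k x := by
    calc D i x = ∑ k, z k * D i x := by rw [← Finset.sum_mul, hz, one_mul]
      _ ≤ ∑ k, z k * (c * D k x) := Finset.sum_le_sum fun k _ => by gcongr; exact h k
      _ = _ := by rw [Finset.mul_sum]; exact Finset.sum_congr rfl fun k _ => by ring
  have h2 : gmsa z D G x = (∑ k, z k * (D k x * G k x)) / ∑ k, z k * D k x := by
    rw [gmsa, Finset.sum_div]
    exact Finset.sum_congr rfl fun k _ => by rw [smul_eq_mul]; ring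
  rw [h2]
  calc D i x * ((∑ k, z k * (D k x * G k x)) / ∑ k, z k * D k x)
      ≤ c * (∑ k, z k * D k x) * ((∑ k, z k * (D k x * G k x)) / ∑ k, z k * D k x) := by gcongr
    _ = c * ((∑ k, z k * D k x) * ((∑ k, z k * (D k x * G k x)) / ∑ k, z k * D k x)) := by ring
    _ ≤ _ := by gcongr; rw [mul_div_left_comm]; exact mul_le_of_le_one_right' (div_self_le_one _)

variable {m : ℕ} {K : X → X → ℝ≥0} {S : Fin m → X × Fin p} {k : Fin p}

lemma kde_le_mul_of_average_lt {f g : X → ℝ≥0} {a : ℝ} {u : X}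
    (hg : ∀ i, K u (S i).1 ≤ g (S i).1 * f u)
    (hS : ∑ i with (S i).2 = k, ((g (S i).1 : ℝ) - a) < 0) :
    (kde K S k u : ℝ) ≤ a * f u := by
  rw [Finset.sum_sub_distrib, Finset.sum_const, nsmul_eq_mul, sub_neg] at hS
  set s := Finset.univ.filter fun i => (S i).2 = k with hs
  have hn : (0 : ℝ) < s.card := by
    rw [Nat.cast_pos, Finset.card_pos]
    by_contra h
    rw [Finset.not_nonempty_iff_eq_empty] at h
    simp [h] at hS
  have h1 : ∑ i ∈ s, (K u (S i).1 : ℝ) ≤ (∑ i ∈ s, (g (S i).1 : ℝ)) * f u := by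
    rw [Finset.sum_mul]
    exact Finset.sum_le_sum fun i _ => by exact_mod_cast hg i
  rw [kde, NNReal.coe_div, NNReal.coe_sum, NNReal.coe_natCast, div_le_iff₀ hn]
  calc _ ≤ (∑ i ∈ s, (g (S i).1 : ℝ)) * f u := h1
    _ ≤ (s.card * a) * f u := by gcongr
    _ = _ := by ring

/-- By the Cauchy–Schwarz inequality, the harmonic mean of the values `K u xᵢ` is at most their
arithmetic mean. -/
lemma le_mul_kde_of_average_lt {f g : X → ℝ≥0} {a : ℝ} {u : X}
    (hg : ∀ i, f u ≤ g (S i).1 * K u (S i).1)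
    (hS : ∑ i with (S i).2 = k, ((g (S i).1 : ℝ) - a) < 0) :
    (f u : ℝ) ≤ a * kde K S k u := by
  rw [Finset.sum_sub_distrib, Finset.sum_const, nsmul_eq_mul, sub_neg] at hS
  set s := Finset.univ.filter fun i => (S i).2 = k with hs
  have hn : (0 : ℝ) < s.card := by
    rw [Nat.cast_pos, Finset.card_pos]
    by_contra h
    rw [Finset.not_nonempty_iff_eq_empty] at h
    simp [h] at hS
  have h1 := Finset.sum_sq_le_sum_mul_sum_of_sq_le_mul s (r := fun _ => √(f u))
    (f := fun i => (g (S i).1 : ℝ)) (g := fun i => (K u (S i).1 : ℝ)) (fun _ _ => NNReal.coe_nonneg _)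
    (fun _ _ => NNReal.coe_nonneg _) fun i _ => by
      rw [Real.sq_sqrt (NNReal.coe_nonneg _)]; exact_mod_cast hg i
  rw [Finset.sum_const, nsmul_eq_mul, mul_pow, Real.sq_sqrt (NNReal.coe_nonneg _)] at h1
  have hK0 : 0 ≤ ∑ i ∈ s, (K u (S i).1 : ℝ) := Finset.sum_nonneg fun _ _ => NNReal.coe_nonneg _
  rw [kde, NNReal.coe_div, NNReal.coe_sum, NNReal.coe_natCast, ← mul_div_assoc, le_div_iff₀ hn]
  refine le_of_mul_le_mul_left ?_ hn
  calc (s.card : ℝ) * (f u * s.card) = s.card ^ 2 * f u := by ring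
    _ ≤ _ := h1
    _ ≤ (s.card * a) * ∑ i ∈ s, (K u (S i).1 : ℝ) := by gcongr
    _ = _ := by ring

lemma kde_pos (hKpos : ∀ x x', 0 < K x x') {i : Fin m} (hi : (S i).2 = k) (u : X) :
    0 < kde K S k u := by
  have hmem : i ∈ Finset.univ.filter fun i => (S i).2 = k := by simpa using hi
  exact div_pos (Finset.sum_pos (fun _ _ => hKpos _ _) ⟨i, hmem⟩)
    (by exact_mod_cast Finset.card_pos.2 ⟨i, hmem⟩)

lemma sum_mul_kde_pos (hm : 0 < m) (hKpos : ∀ x x', 0 < K x x') {z : Fin p → ℝ≥0}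
    (hz : ∀ k, 0 < z k) (u : X) : 0 < ∑ k, z k * kde K S k u :=
  Finset.sum_pos' (fun _ _ => zero_le) ⟨(S ⟨0, hm⟩).2, Finset.mem_univ _,
    mul_pos (hz _) (kde_pos hKpos rfl u)⟩

lemma kde_le_mul_kde {κ : ℝ≥0} (hκ : ∀ u x x', K u x ≤ κ * K u x') {i : Fin m} {l : Fin p}
    (hi : (S i).2 = l) (u : X) : kde K S k u ≤ κ * kde K S l u := by
  have hn : (0 : ℝ≥0) < (Finset.univ.filter fun i => (S i).2 = l).card := by
    exact_mod_cast Finset.card_pos.2 ⟨i, by simpa using hi⟩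
  have h1 : ∀ j, kde K S k u ≤ κ * K u (S j).1 := fun j => by
    rw [kde]
    refine NNReal.div_le_of_le_mul ?_
    calc ∑ i with (S i).2 = k, K u (S i).1 ≤ ∑ i with (S i).2 = k, κ * K u (S j).1 :=
          Finset.sum_le_sum fun i _ => hκ _ _ _
      _ = _ := by rw [Finset.sum_const, nsmul_eq_mul, mul_comm]
  rw [kde.eq_def K S l u, ← mul_div_assoc, le_div_iff₀ hn, Finset.mul_sum, mul_comm, ← nsmul_eq_mul]
  exact Finset.card_nsmul_le_sum _ _ _ fun j _ => h1 j

/-- If all values of the kernel at a point agree up to the factor `κ`, the weights of the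
combination agree up to `κ` with weights that do not depend on the point. -/
lemma exists_gmsa_kde_le (hm : 0 < m) (hKpos : ∀ x x', 0 < K x x') {κ : ℝ≥0}
    (hκ : ∀ u x x', K u x ≤ κ * K u x') {z : Fin p → ℝ≥0} (hz : ∀ k, 0 < z k)
    (S : Fin m → X × Fin p) (G : Fin p → X → ℝ≥0) :
    ∃ v : Fin p → ℝ≥0, ∑ k, v k = 1 ∧ ∀ u, gmsa z (kde K S) G u ≤ κ * ∑ k, v k * G k u := by
  classical
  set w : Fin p → ℝ≥0 := fun k => if ∃ i, (S i).2 = k then z k else 0 with hw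
  have hW : 0 < ∑ k, w k := Finset.sum_pos' (fun _ _ => zero_le) ⟨(S ⟨0, hm⟩).2, Finset.mem_univ _,
    by rw [hw]; simpa using hz _⟩
  refine ⟨fun k => w k / ∑ j, w j, by rw [← Finset.sum_div, div_self hW.ne'], fun u => ?_⟩
  rw [gmsa, Finset.mul_sum]
  refine Finset.sum_le_sum fun k _ => ?_
  rw [smul_eq_mul, ← mul_assoc]
  gcongr
  by_cases hk : ∃ i, (S i).2 = k
  · have hwk : w k = z k := if_pos hk
    rw [div_le_iff₀ (sum_mul_kde_pos hm hKpos hz u)]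
    have h1 : (∑ j, w j) * kde K S k u ≤ κ * ∑ j, z j * kde K S j u := by
      rw [Finset.sum_mul, Finset.mul_sum]
      refine Finset.sum_le_sum fun j _ => ?_
      by_cases hj : ∃ i, (S i).2 = j
      · obtain ⟨i, hi⟩ := hj
        have hwj : w j = z j := if_pos ⟨i, hi⟩
        rw [hwj]
        calc z j * kde K S k u ≤ z j * (κ * kde K S j u) := by
              gcongr; exact kde_le_mul_kde hκ hi u
          _ = _ := by ring
      · have hwj : w j = 0 := if_neg hj
        simp [hwj]
    calc z k * kde K S k u = w k / (∑ j, w j) * ((∑ j, w j) * kde K S k u) := by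
          rw [hwk]; field_simp
      _ ≤ w k / (∑ j, w j) * (κ * ∑ j, z j * kde K S j u) := by gcongr
      _ = _ := by ring
  · have : kde K S k u = 0 := by
      rw [kde, Finset.filter_false_of_mem fun i _ h => hk ⟨i, h⟩]
      simp
    simp [this]

end Comparison

/-! ### Loss bounds on the source domains -/

section Numeric

/-- The geometric mean in the bound, in terms of the fourth root `v` of `M / ε`. -/
lemma exists_fourth_root {ε : ℝ≥0} (hε : 0 < ε) (M : ℝ≥0) :
    ∃ v : ℝ≥0, M = ε * v ^ 4 ∧ ε ^ (1 / 4 : ℝ) * M ^ (3 / 4 : ℝ) = ε * v ^ 3 := by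
  refine ⟨(M / ε) ^ (1 / 4 : ℝ), ?_, ?_⟩
  · rw [← NNReal.rpow_natCast, ← NNReal.rpow_mul]
    norm_num
    rw [mul_div_cancel₀ _ hε.ne']
  · rw [← NNReal.rpow_natCast, ← NNReal.rpow_mul]
    norm_num
    rw [NNReal.div_rpow, ← mul_div_assoc, eq_div_iff (by positivity)]
    calc ε ^ (1 / 4 : ℝ) * M ^ (3 / 4 : ℝ) * ε ^ (3 / 4 : ℝ)
        = (ε ^ (1 / 4 : ℝ) * ε ^ (3 / 4 : ℝ)) * M ^ (3 / 4 : ℝ) := by ring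
      _ = _ := by rw [← NNReal.rpow_add hε.ne']; norm_num

lemma mul_one_add_log_le {v : ℝ} (hv : 3 / 2 ≤ v) :
    9 / 8 * (1 + Real.log (v ^ 4)) ≤ v ^ 3 := by
  have h1 : Real.log (v / (3 / 2)) ≤ v / (3 / 2) - 1 := Real.log_le_sub_one_of_pos (by positivity)
  have h2 : Real.log (3 / 2) ≤ 3 / 2 - 1 := Real.log_le_sub_one_of_pos (by norm_num)
  rw [Real.log_div (by positivity) (by norm_num)] at h1
  rw [Real.log_pow]
  push_cast
  nlinarith [mul_nonneg (sub_nonneg.2 hv) (sub_nonneg.2 hv), sq_nonneg v]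

lemma log_le_half {x : ℝ} (hx : 0 < x) : Real.log x ≤ x / 2 := by
  have h1 : Real.log (x / 2) ≤ x / 2 - 1 := Real.log_le_sub_one_of_pos (by positivity)
  have h2 : Real.log 2 ≤ 2 - 1 := Real.log_le_sub_one_of_pos (by norm_num)
  rw [Real.log_div hx.ne' (by norm_num)] at h1
  linarith

end Numeric

section LossBounds

variable {X : Type*} [MeasurableSpace X] {μ : Measure X} {p : ℕ} {D G : Fin p → X → ℝ≥0}

lemma lintegral_mul_gmsa_le_bound (hD : ∀ k, Measurable (D k))
    (hD1 : ∀ k, ∫⁻ x, (D k x : ℝ≥0∞) ∂μ = 1) {M : ℝ≥0} (hGM : ∀ k x, G k x ≤ M)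
    (z : Fin p → ℝ≥0) (D' : Fin p → X → ℝ≥0) (i : Fin p) :
    ∫⁻ x, (D i x * gmsa z D' G x : ℝ≥0) ∂μ ≤ M := by
  calc ∫⁻ x, (D i x * gmsa z D' G x : ℝ≥0) ∂μ ≤ ∫⁻ x, D i x * (M : ℝ≥0∞) ∂μ := by
        refine lintegral_mono fun x => ?_
        rw [← ENNReal.coe_mul, ENNReal.coe_le_coe]
        gcongr
        exact gmsa_le fun k => hGM k x
    _ = M := by rw [lintegral_mul_const _ (hD i).coe_nnreal_ennreal, hD1, one_mul]

lemma lintegral_sum_mul_le (hD : ∀ k, Measurable (D k)) (hG : ∀ k, Measurable (G k)) {ε : ℝ≥0}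
    (hDG : ∀ k, ∫⁻ x, (D k x * G k x : ℝ≥0) ∂μ ≤ ε) {z : Fin p → ℝ≥0} (hz : ∑ k, z k = 1)
    (c : ℝ≥0) :
    ∫⁻ x, (c * ∑ k, z k * (D k x * G k x) : ℝ≥0) ∂μ ≤ (c * ε : ℝ≥0) := by
  have hm : ∀ k, Measurable fun x => ((D k x * G k x : ℝ≥0) : ℝ≥0∞) := fun k =>
    ((hD k).mul (hG k)).coe_nnreal_ennreal
  have h : ∀ x, ((c * ∑ k, z k * (D k x * G k x) : ℝ≥0) : ℝ≥0∞)
      = c * ∑ k, z k * ((D k x * G k x : ℝ≥0) : ℝ≥0∞) := fun x => by push_cast; rfl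
  simp only [h]
  rw [lintegral_const_mul _ (Finset.measurable_fun_sum _ fun k _ => (hm k).const_mul _),
    lintegral_finsetSum _ fun k _ => (hm k).const_mul _, ENNReal.coe_mul]
  gcongr
  calc ∑ k, ∫⁻ x, z k * ((D k x * G k x : ℝ≥0) : ℝ≥0∞) ∂μ ≤ ∑ k, (z k : ℝ≥0∞) * ε :=
        Finset.sum_le_sum fun k _ => by
          rw [lintegral_const_mul _ (hm k)]; gcongr; exact hDG k
    _ = ε := by rw [← Finset.sum_mul, ← ENNReal.ofNNReal_finsetSum, hz, ENNReal.coe_one, one_mul]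

/-- Bound for sources whose densities agree up to the factor `c`. -/
lemma lintegral_mul_gmsa_le_of_ratio (hD : ∀ k, Measurable (D k)) (hG : ∀ k, Measurable (G k))
    {ε : ℝ≥0} (hDG : ∀ k, ∫⁻ x, (D k x * G k x : ℝ≥0) ∂μ ≤ ε) {z : Fin p → ℝ≥0}
    (hz : ∑ k, z k = 1) {c : ℝ≥0} {i : Fin p} (h : ∀ j, ∀ᵐ x ∂μ, D i x ≤ c * D j x) :
    ∫⁻ x, (D i x * gmsa z D G x : ℝ≥0) ∂μ ≤ (c * ε : ℝ≥0) := by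
  refine le_trans (lintegral_mono_ae ?_) (lintegral_sum_mul_le hD hG hDG hz c)
  filter_upwards [ae_all_iff.2 h] with x hx
  exact_mod_cast mul_gmsa_le_of_le_mul hz hx

lemma lintegral_mul_gmsa_kde_le_of_ratio {m : ℕ} {K : X → X → ℝ≥0} (hm : 0 < m)
    (hKpos : ∀ x x', 0 < K x x') {κ : ℝ≥0} (hκ : ∀ u x x', K u x ≤ κ * K u x')
    (hD : ∀ k, Measurable (D k)) (hG : ∀ k, Measurable (G k))
    {ε : ℝ≥0} (hDG : ∀ k, ∫⁻ x, (D k x * G k x : ℝ≥0) ∂μ ≤ ε) {z : Fin p → ℝ≥0}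
    (hz : ∀ k, 0 < z k) {c : ℝ≥0} {i : Fin p} (h : ∀ j, ∀ᵐ x ∂μ, D i x ≤ c * D j x)
    (S : Fin m → X × Fin p) :
    ∫⁻ x, (D i x * gmsa z (kde K S) G x : ℝ≥0) ∂μ ≤ (κ * c * ε : ℝ≥0) := by
  obtain ⟨v, hv, hle⟩ := exists_gmsa_kde_le hm hKpos hκ hz S G
  refine le_trans (lintegral_mono_ae ?_) (lintegral_sum_mul_le hD hG hDG hv (κ * c))
  filter_upwards [ae_all_iff.2 h] with x hx
  norm_cast
  calc D i x * gmsa z (kde K S) G x ≤ D i x * (κ * ∑ k, v k * G k x) := by gcongr; exact hle x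
    _ = κ * ∑ k, v k * (D i x * G k x) := by
        simp only [Finset.mul_sum]; exact Finset.sum_congr rfl fun k _ => by ring
    _ ≤ κ * ∑ k, v k * (c * D k x * G k x) := by gcongr with k _; exact hx k
    _ = _ := by
        simp only [Finset.mul_sum]; exact Finset.sum_congr rfl fun k _ => by ring

lemma lintegral_mul_gmsa_kde_le_of_compare {D' : Fin p → X → ℝ≥0} (hD : ∀ k, Measurable (D k))
    (hG : ∀ k, Measurable (G k)) {a b A : ℝ≥0} {z : Fin p → ℝ≥0} {i : Fin p}
    (h1 : ∀ k, ∀ᵐ x ∂μ, D' k x ≤ a * D k x) (h2 : ∀ k, ∀ᵐ x ∂μ, D k x ≤ b * D' k x)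
    (hA : ∫⁻ x, (D i x * gmsa z D G x : ℝ≥0) ∂μ ≤ A) :
    ∫⁻ x, (D i x * gmsa z D' G x : ℝ≥0) ∂μ ≤ (a * b * A : ℝ≥0) := by
  have hm : Measurable fun x => ((D i x * gmsa z D G x : ℝ≥0) : ℝ≥0∞) :=
    ((hD i).mul (measurable_gmsa z hD hG)).coe_nnreal_ennreal
  calc ∫⁻ x, (D i x * gmsa z D' G x : ℝ≥0) ∂μ
      ≤ ∫⁻ x, (a * b : ℝ≥0) * ((D i x * gmsa z D G x : ℝ≥0) : ℝ≥0∞) ∂μ := by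
        refine lintegral_mono_ae ?_
        filter_upwards [ae_all_iff.2 h1, ae_all_iff.2 h2] with x hx1 hx2
        norm_cast
        calc D i x * gmsa z D' G x ≤ D i x * (a * b * gmsa z D G x) := by
              gcongr; exact gmsa_le_mul_gmsa hx1 hx2
          _ = _ := by ring
    _ ≤ _ := by
        rw [lintegral_const_mul _ hm, ENNReal.coe_mul (a * b)]
        gcongr

/-- The loss on the source domains of the combination formed with the true densities. If
`d * d' ≤ 3 / 2`, the densities are close to one another; otherwise `M / ε` is so large that the
logarithmic factor lost by `exists_weights` is absorbed. -/
lemma lintegral_mul_gmsa_le_geom_mean (hD : ∀ k, Measurable (D k)) (hG : ∀ k, Measurable (G k))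
    {ε M : ℝ≥0} (hε : 0 < ε) (hDG : ∀ k, ∫⁻ x, (D k x * G k x : ℝ≥0) ∂μ ≤ ε) {z : Fin p → ℝ≥0}
    (hz : ∑ k, z k = 1) {d d' : ℝ≥0} (hd : 1 ≤ d * d') (hM : ε * (d * d') ^ 4 ≤ M) {i : Fin p}
    (hlog : ∫⁻ x, (D i x * gmsa z D G x : ℝ≥0) ∂μ
      ≤ ENNReal.ofReal (9 / 8 * (ε * (1 + Real.log (M / ε)))))
    (hratio : d * d' ≤ 3 / 2 → ∀ j, ∀ᵐ x ∂μ, D i x ≤ (d * d') ^ 2 * D j x) :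
    ∫⁻ x, (D i x * gmsa z D G x : ℝ≥0) ∂μ ≤ (ε ^ (1 / 4 : ℝ) * M ^ (3 / 4 : ℝ) : ℝ≥0) := by
  obtain ⟨v, hv, hA⟩ := exists_fourth_root hε M
  have hPv : d * d' ≤ v := by
    rw [hv, mul_le_mul_iff_right₀ hε] at hM
    exact (pow_le_pow_iff_left₀ zero_le zero_le four_ne_zero).1 hM
  rw [hA]
  rcases le_total (d * d') (3 / 2) with h | h
  · refine (lintegral_mul_gmsa_le_of_ratio hD hG hDG hz (hratio h)).trans ?_
    norm_cast
    rw [mul_comm]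
    refine mul_le_mul' le_rfl ?_
    calc (d * d') ^ 2 ≤ (d * d') ^ 3 := pow_le_pow_right₀ hd (by norm_num)
      _ ≤ v ^ 3 := by gcongr
  · refine hlog.trans ?_
    rw [← ENNReal.ofReal_coe_nnreal]
    refine ENNReal.ofReal_le_ofReal ?_
    have hε' : (0 : ℝ) < ε := by exact_mod_cast hε
    have hv32 : (3 / 2 : ℝ) ≤ v := by exact_mod_cast h.trans hPv
    rw [hv]
    push_cast
    rw [mul_div_cancel_left₀ _ hε'.ne']
    calc 9 / 8 * ((ε : ℝ) * (1 + Real.log (v ^ 4))) = ε * (9 / 8 * (1 + Real.log (v ^ 4))) := by ring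
      _ ≤ _ := by gcongr; exact mul_one_add_log_le hv32

end LossBounds

/-! ### Functions dominating the density ratios -/

section Core

variable {X : Type*} [MeasurableSpace X] {μ : Measure X} {p : ℕ} {D : Fin p → X → ℝ≥0}
  {K : X → X → ℝ≥0}

lemma one_le_dStar (hp : 0 < p) (hD : ∀ k, Measurable (D k))
    (hD1 : ∀ k, ∫⁻ x, (D k x : ℝ≥0∞) ∂μ = 1) (hK : Measurable (uncurry K))
    (hK1 : ∀ x', ∫⁻ x, (K x x' : ℝ≥0∞) ∂μ = 1) : 1 ≤ dStar μ D K := by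
  have := isProbabilityMeasure_law (hD1 ⟨0, hp⟩)
  refine le_iSup_of_le ⟨0, hp⟩ ?_
  calc (1 : ℝ≥0∞) = ∫⁻ _, 1 ∂(law μ (D ⟨0, hp⟩)) := by simp
    _ ≤ _ := lintegral_mono fun x => one_le_renyiExpTop
        (hK.comp (measurable_id.prodMk measurable_const)) (hD _) (hK1 x) (hD1 _)

lemma one_le_dStar' (hp : 0 < p) (hD : ∀ k, Measurable (D k))
    (hD1 : ∀ k, ∫⁻ x, (D k x : ℝ≥0∞) ∂μ = 1) (hK : Measurable (uncurry K))
    (hK1 : ∀ x', ∫⁻ x, (K x x' : ℝ≥0∞) ∂μ = 1) : 1 ≤ dStar' μ D K := by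
  have := isProbabilityMeasure_law (hD1 ⟨0, hp⟩)
  refine le_iSup_of_le ⟨0, hp⟩ ?_
  calc (1 : ℝ≥0∞) = ∫⁻ _, 1 ∂(law μ (D ⟨0, hp⟩)) := by simp
    _ ≤ _ := lintegral_mono fun x => one_le_renyiExpTop (hD _)
        (hK.comp (measurable_id.prodMk measurable_const)) (hD1 _) (hK1 x)

/-- A function whose values agree up to the factor `c` is bounded by `c` times its mean. -/
lemma le_mul_of_forall_le_mul {ν : Measure X} [IsProbabilityMeasure ν] {f : X → ℝ≥0∞}
    (hf : Measurable f) {c d : ℝ≥0∞} (hfc : ∀ x x', f x ≤ c * f x') (hfd : ∫⁻ x, f x ∂ν ≤ d)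
    (x : X) : f x ≤ c * d := by
  calc f x = ∫⁻ _, f x ∂ν := by simp
    _ ≤ ∫⁻ x', c * f x' ∂ν := lintegral_mono fun x' => hfc x x'
    _ ≤ c * d := by rw [lintegral_const_mul _ hf]; gcongr

/-- The function `x ↦ d_∞(K(·, x) ‖ D k)`, which is finite since it has finite mean and varies at most
by the factor `κ`. -/
lemma exists_dominating_left [SFinite μ] (hD : ∀ k, Measurable (D k))
    (hD1 : ∀ k, ∫⁻ x, (D k x : ℝ≥0∞) ∂μ = 1)
    (hK : Measurable (uncurry K)) (hKpos : ∀ x x', 0 < K x x')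
    (hK1 : ∀ x', ∫⁻ x, (K x x' : ℝ≥0∞) ∂μ = 1) {κ d : ℝ≥0} (hκ : kappa K = κ)
    (hd : dStar μ D K = d) (k : Fin p) :
    ∃ g : X → ℝ≥0, Measurable g ∧ (∀ x, 1 ≤ g x) ∧ (∀ x, g x ≤ κ * d) ∧
      (∀ x, ∀ᵐ u ∂μ, K u x ≤ g x * D k u) ∧ ∫⁻ x, (D k x * g x : ℝ≥0) ∂μ ≤ d := by
  have := isProbabilityMeasure_law (hD1 k)
  have hKx : ∀ x, Measurable (fun u => K u x) := fun x =>
    hK.comp (measurable_id.prodMk measurable_const)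
  have hm := measurable_renyiExpTop_left (hD k) hK hK1
  have hint : ∫⁻ x, renyiExpTop μ (fun u => K u x) (D k) ∂(law μ (D k)) ≤ d :=
    hd ▸ le_iSup (fun k => ∫⁻ x, renyiExpTop μ (fun u => K u x) (D k) ∂(law μ (D k))) k
  have hle := le_mul_of_forall_le_mul hm
    (fun x x' => hκ ▸ renyiExpTop_left_le_kappa_mul (hD k) hK hKpos hK1 x x') hint
  have hfin : ∀ x, renyiExpTop μ (fun u => K u x) (D k) ≠ ∞ := fun x =>
    ne_top_of_le_ne_top (by finiteness) (hle x)
  have hcoe : ∀ x, ((renyiExpTop μ (fun u => K u x) (D k)).toNNReal : ℝ≥0∞)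
      = renyiExpTop μ (fun u => K u x) (D k) := fun x => ENNReal.coe_toNNReal (hfin x)
  refine ⟨fun x => (renyiExpTop μ (fun u => K u x) (D k)).toNNReal, hm.ennreal_toNNReal,
    fun x => ?_, fun x => ?_, fun x => ?_, ?_⟩
  · rw [← ENNReal.coe_le_coe, hcoe]
    exact one_le_renyiExpTop (hKx x) (hD k) (hK1 x) (hD1 k)
  · rw [← ENNReal.coe_le_coe, hcoe]
    exact_mod_cast hle x
  · filter_upwards [ae_le_renyiExpTop_mul (hKx x) (hD k) (hK1 x) (hfin x)] with u hu
    rw [← ENNReal.coe_le_coe, ENNReal.coe_mul, hcoe]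
    exact hu
  · rw [lintegral_law (hD k) hm] at hint
    simpa only [ENNReal.coe_mul, hcoe] using hint

/-- The function `x ↦ d_∞(D k ‖ K(·, x))`, finite for the same reason. -/
lemma exists_dominating_right [SFinite μ] (hD : ∀ k, Measurable (D k))
    (hD1 : ∀ k, ∫⁻ x, (D k x : ℝ≥0∞) ∂μ = 1)
    (hK : Measurable (uncurry K)) (hKpos : ∀ x x', 0 < K x x')
    {κ d : ℝ≥0} (hκ : kappa K = κ)
    (hd : dStar' μ D K = d) (k : Fin p) :
    ∃ g : X → ℝ≥0, Measurable g ∧ (∀ x, g x ≤ κ * d) ∧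
      (∀ x, ∀ᵐ u ∂μ, D k u ≤ g x * K u x) ∧ ∫⁻ x, (D k x * g x : ℝ≥0) ∂μ ≤ d := by
  have := isProbabilityMeasure_law (hD1 k)
  have hKx : ∀ x, Measurable (fun u => K u x) := fun x =>
    hK.comp (measurable_id.prodMk measurable_const)
  have hm := measurable_renyiExpTop_right (hD k) hK (hD1 k)
  have hint : ∫⁻ x, renyiExpTop μ (D k) (fun u => K u x) ∂(law μ (D k)) ≤ d :=
    hd ▸ le_iSup (fun k => ∫⁻ x, renyiExpTop μ (D k) (fun u => K u x) ∂(law μ (D k))) k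
  have hle := le_mul_of_forall_le_mul hm
    (fun x x' => hκ ▸ renyiExpTop_right_le_kappa_mul (hD k) hK hKpos (hD1 k) x x') hint
  have hfin : ∀ x, renyiExpTop μ (D k) (fun u => K u x) ≠ ∞ := fun x =>
    ne_top_of_le_ne_top (by finiteness) (hle x)
  have hcoe : ∀ x, ((renyiExpTop μ (D k) (fun u => K u x)).toNNReal : ℝ≥0∞)
      = renyiExpTop μ (D k) (fun u => K u x) := fun x => ENNReal.coe_toNNReal (hfin x)
  refine ⟨fun x => (renyiExpTop μ (D k) (fun u => K u x)).toNNReal, hm.ennreal_toNNReal,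
    fun x => ?_, fun x => ?_, ?_⟩
  · rw [← ENNReal.coe_le_coe, hcoe]
    exact_mod_cast hle x
  · filter_upwards [ae_le_renyiExpTop_mul (hD k) (hKx x) (hD1 k) (hfin x)] with u hu
    rw [← ENNReal.coe_le_coe, ENNReal.coe_mul, hcoe]
    exact hu
  · rw [lintegral_law (hD k) hm] at hint
    simpa only [ENNReal.coe_mul, hcoe] using hint

/-- The exponent of `sampleLaw_average_le` at the deviation used in the theorem, where
`2 * τ ^ 2 / κ ^ 2 = 9 * L / n` with `n = m / p` and `L = log (p / δ)`. -/
lemma exp_concentration_le {n L : ℝ} (hL : 0 < L) (hn : 18 * L ≤ n) :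
    Real.exp (-(n * (1 - Real.exp (-(9 * L / n))))) ≤ Real.exp (-(6 * L)) := by
  have hn0 : 0 < n := by linarith
  set q := 9 * L / n with hq
  have hq0 : 0 < q := by positivity
  have hq1 : q ≤ 1 / 2 := by rw [hq, div_le_iff₀ hn0]; linarith
  have hnq : n * q = 9 * L := by rw [hq]; field_simp
  have h1 : Real.exp (-q) ≤ 1 / (1 + q) := by
    rw [Real.exp_neg, ← one_div]
    exact one_div_le_one_div_of_le (by linarith) (by linarith [Real.add_one_le_exp q])
  have h2 : 1 / (1 + q) ≤ 1 - 2 / 3 * q := by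
    rw [div_le_iff₀ (by linarith)]; nlinarith
  rw [Real.exp_le_exp, neg_le_neg_iff]
  calc 6 * L = n * (2 / 3 * q) := by linarith
    _ ≤ n * (1 - Real.exp (-q)) := by gcongr; linarith

/-- The form of `sampleLaw_average_le` for functions with values in `ℝ≥0` and a mean bound expressed
by a Lebesgue integral. -/
lemma sampleLaw_average_nnreal_le (hp : 0 < p) (hD : ∀ k, Measurable (D k))
    (hD1 : ∀ k, ∫⁻ x, (D k x : ℝ≥0∞) ∂μ = 1) (m : ℕ)
    {κ d : ℝ≥0} (hκ : 0 < κ) (hd : 0 < d) {g : Fin p → X → ℝ≥0}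
    (hg : ∀ k, Measurable (g k)) (hgκ : ∀ k x, g k x ≤ κ * d)
    (hgd : ∀ k, ∫⁻ x, (D k x * g k x : ℝ≥0) ∂μ ≤ d) {τ : ℝ} (hτ : 0 < τ) (k : Fin p) :
    sampleLaw μ D m {S | 0 ≤ ∑ i with (S i).2 = k, ((g k (S i).1 : ℝ) - (1 + τ) * d)}
      ≤ ENNReal.ofReal (Real.exp (-(m / p * (1 - Real.exp (-(2 * τ ^ 2 / κ ^ 2)))))) := by
  have := isProbabilityMeasure_labeledLaw hp hD1
  have hprob : IsProbabilityMeasure (sampleLaw μ D m) := by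
    unfold sampleLaw; infer_instance
  have := isProbabilityMeasure_law (hD1 k)
  have h := sampleLaw_average_le hp hD1 m k (g := fun x => (g k x : ℝ)) (hg k).coe_nnreal_real
    (c := κ) (d := d) (τ := τ) (by exact_mod_cast hκ) (by exact_mod_cast hd) hτ
    (fun x => NNReal.coe_nonneg _) (fun x => by exact_mod_cast hgκ k x) (by
      have hgm : Measurable fun x => (g k x : ℝ≥0∞) := (hg k).coe_nnreal_ennreal
      have h1 : ∫⁻ x, (g k x : ℝ≥0∞) ∂(law μ (D k)) ≤ d := by
        rw [lintegral_law (hD k) hgm]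
        simpa using hgd k
      rw [lintegral_coe_eq_integral _ (integrable_coe_of_lintegral_ne_top (hg k)
        (ne_top_of_le_ne_top ENNReal.coe_ne_top h1)), ← ENNReal.ofReal_coe_nnreal,
        ENNReal.ofReal_le_ofReal_iff d.coe_nonneg] at h1
      exact h1)
  rw [← ENNReal.ofReal_toReal (measure_ne_top (sampleLaw μ D m) _)]
  exact ENNReal.ofReal_le_ofReal h

end Core

/-! ### Losses that depend on the input only -/

section Core

variable {X : Type*} [MeasurableSpace X] {μ : Measure X} {p m : ℕ} {D : Fin p → X → ℝ≥0}
  {K : X → X → ℝ≥0}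

/-- The bound in the case of finite constants. -/
lemma gmsaBound_eq_ofReal {κ d d' : ℝ≥0} (hκ : kappa K = κ) (hd : dStar μ D K = d)
    (hd' : dStar' μ D K = d') (ε M : ℝ≥0) (δ : ℝ) :
    gmsaBound μ m D K ε M δ = ENNReal.ofReal (Real.exp (κ * (6 / √(2 * ((m : ℝ) / (p : ℝ))) *
      √(Real.log p + Real.log (1 / δ)))) * (d * d') * (ε ^ (1 / 4 : ℝ) * M ^ (3 / 4 : ℝ) : ℝ≥0)) := by
  rw [gmsaBound, hκ, hd, hd', show ((κ : ℝ≥0∞) : EReal) = ((κ : ℝ) : EReal) from rfl,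
    ← EReal.coe_mul, EReal.exp_coe, ENNReal.ofReal_mul (by positivity),
    ENNReal.ofReal_mul (by positivity), ENNReal.ofReal_mul (by positivity),
    ENNReal.ofReal_coe_nnreal, ENNReal.ofReal_coe_nnreal, ENNReal.ofReal_coe_nnreal]
  ring

lemma gmsaBound_eq_top (hp : 0 < p) (hm : 0 < m) (hd : 1 ≤ dStar μ D K) (hd' : 1 ≤ dStar' μ D K)
    {ε M : ℝ≥0} (hε : 0 < ε) (hM : 0 < M) {δ : ℝ} (hδ : 0 < δ) (hδ1 : δ < 1)
    (h : dStar μ D K = ∞ ∨ dStar' μ D K = ∞ ∨ kappa K = ∞) :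
    gmsaBound μ m D K ε M δ = ∞ := by
  have hA : ((ε ^ (1 / 4 : ℝ) * M ^ (3 / 4 : ℝ) : ℝ≥0) : ℝ≥0∞) ≠ 0 := by
    have : 0 < ε ^ (1 / 4 : ℝ) * M ^ (3 / 4 : ℝ) := by positivity
    exact_mod_cast this.ne'
  have hc : 0 < 6 / √(2 * ((m : ℝ) / (p : ℝ))) * √(Real.log p + Real.log (1 / δ)) := by
    have h1 : 0 ≤ Real.log p := Real.log_natCast_nonneg p
    have h2 : 0 < Real.log (1 / δ) := Real.log_pos ((one_lt_div hδ).2 hδ1)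
    have hp' : (0 : ℝ) < p := by exact_mod_cast hp
    have hm' : (0 : ℝ) < m := by exact_mod_cast hm
    positivity
  set c := 6 / √(2 * ((m : ℝ) / (p : ℝ))) * √(Real.log p + Real.log (1 / δ)) with hc_def
  have hE : 1 ≤ EReal.exp ((kappa K : EReal) * (c : EReal)) := by
    rw [EReal.one_le_exp_iff]
    exact mul_nonneg (EReal.coe_ennreal_nonneg _) (by exact_mod_cast hc.le)
  have hE0 := (zero_lt_one.trans_le hE).ne'
  have hd0 := (zero_lt_one.trans_le hd).ne'
  have hd0' := (zero_lt_one.trans_le hd').ne'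
  rw [gmsaBound, ← hc_def]
  rcases h with h | h | h
  · rw [h, ENNReal.mul_top (mul_ne_zero hA hE0), ENNReal.top_mul hd0']
  · rw [h, ENNReal.mul_top (mul_ne_zero (mul_ne_zero hA hE0) hd0)]
  · rw [h, EReal.coe_ennreal_top, EReal.top_mul_coe_of_pos hc, EReal.exp_top,
      ENNReal.mul_top hA, ENNReal.top_mul hd0, ENNReal.top_mul hd0']

lemma le_measure_of_compl_le {Ω : Type*} [MeasurableSpace Ω] {ν : Measure Ω}
    [IsProbabilityMeasure ν] {A B : Set Ω} {δ : ℝ} (hAB : Aᶜ ⊆ B) (hB : ν B ≤ ENNReal.ofReal δ)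
    (hδ : 0 ≤ δ) : ENNReal.ofReal (1 - δ) ≤ ν A := by
  rw [ENNReal.ofReal_sub _ hδ, ENNReal.ofReal_one, tsub_le_iff_right]
  calc (1 : ℝ≥0∞) = ν Set.univ := measure_univ.symm
    _ = ν (A ∪ Aᶜ) := by rw [Set.union_compl_self]
    _ ≤ ν A + ν B := (measure_union_le _ _).trans (by gcongr)
    _ ≤ _ := by gcongr

/-- The sampling part: for densities comparable with the kernel through the functions `g` and `g'`,
the combination formed with the estimated densities is, with high probability, within the factor
`exp (κ c) d d'` of the one formed with the true densities. If `exp (κ c) ≥ κ ^ 2`, this holds for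
every sample, by comparing all sources with one another; otherwise the sample is large enough for
the averages of `g` and `g'` to concentrate. -/
lemma sampleLaw_loss_le (hp : 2 ≤ p) (hm : 0 < m) (hD : ∀ k, Measurable (D k))
    (hD1 : ∀ k, ∫⁻ x, (D k x : ℝ≥0∞) ∂μ = 1) (hKpos : ∀ x x', 0 < K x x')
    {κ d d' : ℝ≥0} (hκ1 : 1 ≤ κ) (hd1 : 1 ≤ d) (hd1' : 1 ≤ d')
    (hκ : ∀ u x x', K u x ≤ κ * K u x') {g g' : Fin p → X → ℝ≥0}
    (hg : ∀ k, Measurable (g k)) (hgκ : ∀ k x, g k x ≤ κ * d)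
    (hgK : ∀ k x, ∀ᵐ u ∂μ, K u x ≤ g k x * D k u)
    (hgd : ∀ k, ∫⁻ x, (D k x * g k x : ℝ≥0) ∂μ ≤ d)
    (hg' : ∀ k, Measurable (g' k)) (hgκ' : ∀ k x, g' k x ≤ κ * d')
    (hgK' : ∀ k x, ∀ᵐ u ∂μ, D k u ≤ g' k x * K u x)
    (hgd' : ∀ k, ∫⁻ x, (D k x * g' k x : ℝ≥0) ∂μ ≤ d')
    {G : Fin p → X → ℝ≥0} (hG : ∀ k, Measurable (G k)) {ε A : ℝ≥0} (hεA : ε ≤ A)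
    (hDG : ∀ k, ∫⁻ x, (D k x * G k x : ℝ≥0) ∂μ ≤ ε) {z : Fin p → ℝ≥0} (hz0 : ∀ k, 0 < z k)
    (hA : ∀ i, ∫⁻ x, (D i x * gmsa z D G x : ℝ≥0) ∂μ ≤ A)
    {δ : ℝ} (hδ : 0 < δ) (hδ1 : δ < 1) :
    ENNReal.ofReal (1 - δ) ≤ sampleLaw μ D m {S | ∀ i,
      ∫⁻ x, (D i x * gmsa z (kde K S) G x : ℝ≥0) ∂μ
        ≤ ENNReal.ofReal (Real.exp (κ * (6 / √(2 * ((m : ℝ) / (p : ℝ))) *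
            √(Real.log p + Real.log (1 / δ)))) * (d * d') * A)} := by
  have hp0 : 0 < p := by omega
  have := isProbabilityMeasure_labeledLaw hp0 hD1
  have hprob : IsProbabilityMeasure (sampleLaw μ D m) := by
    unfold sampleLaw; infer_instance
  have hp' : (0 : ℝ) < p := by exact_mod_cast hp0
  have hm' : (0 : ℝ) < m := by exact_mod_cast hm
  have hκ0 : (0 : ℝ) < κ := by exact_mod_cast zero_lt_one.trans_le hκ1
  have hd0 : 0 < d := zero_lt_one.trans_le hd1
  have hd0' : 0 < d' := zero_lt_one.trans_le hd1'
  set n : ℝ := (m : ℝ) / p with hn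
  have hn0 : 0 < n := by positivity
  set L : ℝ := Real.log p + Real.log (1 / δ) with hL
  have hL2 : Real.log 2 ≤ L := by
    have h1 : Real.log 2 ≤ Real.log p := Real.log_le_log (by norm_num) (by exact_mod_cast hp)
    have h2 : 0 < Real.log (1 / δ) := Real.log_pos ((one_lt_div hδ).2 hδ1)
    linarith
  have hL0 : 0 < L := (Real.log_pos (by norm_num)).trans_le hL2
  set c : ℝ := 6 / √(2 * n) * √L with hc
  have hc0 : 0 < c := by positivity
  have hc2 : c ^ 2 = 18 * L / n := by
    rw [hc, mul_pow, div_pow, Real.sq_sqrt (by positivity), Real.sq_sqrt hL0.le]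
    field_simp
    norm_num
  by_cases hbig : 2 * Real.log κ ≤ κ * c
  · -- all densities are comparable with one another
    have hall : ∀ (S : Fin m → X × Fin p) (i : Fin p),
        ∫⁻ x, (D i x * gmsa z (kde K S) G x : ℝ≥0) ∂μ
          ≤ ENNReal.ofReal (Real.exp (κ * c) * (d * d') * A) := by
      intro S i
      have hratio : ∀ j, ∀ᵐ u ∂μ, D i u ≤ κ * (d * d') * D j u := by
        intro j
        have hmean : ∀ {f : X → ℝ≥0} {e : ℝ≥0} (k : Fin p), Measurable f →
            ∫⁻ x, (D k x * f x : ℝ≥0) ∂μ ≤ e → ∃ x, f x ≤ e := by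
          intro f e k hf h
          have := isProbabilityMeasure_law (hD1 k)
          have hfm : Measurable fun x => (f x : ℝ≥0∞) := hf.coe_nnreal_ennreal
          obtain ⟨x, hx⟩ := exists_le_lintegral (μ := law μ (D k)) hfm.aemeasurable
          rw [lintegral_law (hD k) hfm] at hx
          exact ⟨x, ENNReal.coe_le_coe.1 (hx.trans (by simpa using h))⟩
        obtain ⟨x, hx⟩ := hmean i (hg' i) (hgd' i)
        obtain ⟨x', hx'⟩ := hmean j (hg j) (hgd j)
        filter_upwards [hgK' i x, hgK j x'] with u h1 h2
        calc D i u ≤ g' i x * K u x := h1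
          _ ≤ d' * (κ * (d * D j u)) := by
              gcongr
              exact (hκ u x x').trans (by gcongr; exact h2.trans (by gcongr))
          _ = _ := by ring
      refine (lintegral_mul_gmsa_kde_le_of_ratio hm hKpos hκ hD hG hDG hz0 hratio S).trans ?_
      rw [← ENNReal.ofReal_coe_nnreal]
      refine ENNReal.ofReal_le_ofReal ?_
      have hexp : (κ : ℝ) ^ 2 ≤ Real.exp (κ * c) := by
        rw [← Real.log_le_iff_le_exp (by positivity), Real.log_pow]
        exact_mod_cast hbig
      push_cast
      calc (κ : ℝ) * (κ * (d * d')) * ε = κ ^ 2 * (d * d') * ε := by ring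
        _ ≤ Real.exp (κ * c) * (d * d') * A := by gcongr
    rw [Set.eq_univ_of_forall (s := {S | ∀ i, _}) hall, measure_univ]
    exact ENNReal.ofReal_le_one.2 (by linarith)
  · have hnL : 18 * L ≤ n := by
      have h1 : κ * c ≤ κ * 1 := by linarith [log_le_half hκ0]
      have h2 : c ≤ 1 := le_of_mul_le_mul_left h1 hκ0
      have h3 : c ^ 2 ≤ 1 := pow_le_one₀ hc0.le h2
      rwa [hc2, div_le_one hn0] at h3
    set τ : ℝ := κ * c / 2 with hτ
    have hτ0 : 0 < τ := by positivity
    have hτc : 2 * τ ^ 2 / (κ : ℝ) ^ 2 = 9 * L / n := by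
      have : 2 * τ ^ 2 / (κ : ℝ) ^ 2 = c ^ 2 / 2 := by rw [hτ]; field_simp
      rw [this, hc2]; ring
    have hexp := exp_concentration_le hL0 hnL
    set B : Fin p → Set (Fin m → X × Fin p) := fun k =>
      {S | 0 ≤ ∑ i with (S i).2 = k, ((g k (S i).1 : ℝ) - (1 + τ) * d)} with hB
    set B' : Fin p → Set (Fin m → X × Fin p) := fun k =>
      {S | 0 ≤ ∑ i with (S i).2 = k, ((g' k (S i).1 : ℝ) - (1 + τ) * d')} with hB'
    have hBk : ∀ k, sampleLaw μ D m (B k) ≤ ENNReal.ofReal (Real.exp (-(6 * L))) := fun k => by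
      refine (sampleLaw_average_nnreal_le hp0 hD hD1 m (by exact_mod_cast hκ0) hd0 hg hgκ hgd hτ0 k).trans ?_
      rw [hτc]
      exact ENNReal.ofReal_le_ofReal hexp
    have hBk' : ∀ k, sampleLaw μ D m (B' k) ≤ ENNReal.ofReal (Real.exp (-(6 * L))) := fun k => by
      refine (sampleLaw_average_nnreal_le hp0 hD hD1 m (by exact_mod_cast hκ0) hd0' hg' hgκ' hgd' hτ0
        k).trans ?_
      rw [hτc]
      exact ENNReal.ofReal_le_ofReal hexp
    refine le_measure_of_compl_le (B := ⋃ k, (B k ∪ B' k)) ?_ ?_ hδ.le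
    · rw [Set.compl_subset_comm]
      intro S hS
      simp only [Set.mem_compl_iff, Set.mem_iUnion, Set.mem_union, not_exists, not_or] at hS
      have hT : 0 ≤ 1 + τ := by positivity
      obtain ⟨T, hTτ⟩ : ∃ T : ℝ≥0, (T : ℝ) = 1 + τ := ⟨⟨1 + τ, hT⟩, rfl⟩
      have h1 : ∀ k, ∀ᵐ u ∂μ, kde K S k u ≤ (T * d) * D k u := fun k => by
        filter_upwards [ae_all_iff.2 fun i => hgK k (S i).1] with u hu
        have := kde_le_mul_of_average_lt hu (not_le.1 (hS k).1)
        rw [← hTτ] at this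
        exact_mod_cast this
      have h2 : ∀ k, ∀ᵐ u ∂μ, D k u ≤ (T * d') * kde K S k u := fun k => by
        filter_upwards [ae_all_iff.2 fun i => hgK' k (S i).1] with u hu
        have := le_mul_kde_of_average_lt hu (not_le.1 (hS k).2)
        rw [← hTτ] at this
        exact_mod_cast this
      intro i
      refine (lintegral_mul_gmsa_kde_le_of_compare hD hG h1 h2 (hA i)).trans ?_
      rw [← ENNReal.ofReal_coe_nnreal]
      refine ENNReal.ofReal_le_ofReal ?_
      push_cast
      have hT2 : (T : ℝ) ^ 2 ≤ Real.exp (κ * c) := by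
        have h3 : (T : ℝ) ≤ Real.exp τ := by rw [hTτ]; linarith [Real.add_one_le_exp τ]
        calc (T : ℝ) ^ 2 ≤ Real.exp τ ^ 2 := by gcongr
          _ = Real.exp (κ * c) := by rw [← Real.exp_nat_mul]; congr 1; rw [hτ]; push_cast; ring
      calc (T : ℝ) * d * (T * d') * A = T ^ 2 * (d * d') * A := by ring
        _ ≤ _ := by gcongr
    · have hδL : Real.exp (-L) = δ / p := by
        rw [hL, Real.log_div one_ne_zero hδ.ne', Real.log_one, zero_sub, neg_add, neg_neg,
          Real.exp_add, Real.exp_neg, Real.exp_log hp', Real.exp_log hδ]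
        field_simp
      have hhalf : Real.exp (-L) ≤ 1 / 2 := by
        rw [one_div, ← Real.exp_log (show (0 : ℝ) < 2 by norm_num), ← Real.exp_neg]
        exact Real.exp_le_exp.2 (by linarith)
      have h6 : Real.exp (-(6 * L)) ≤ Real.exp (-L) / 2 := by
        have : Real.exp (-(6 * L)) = Real.exp (-L) ^ 4 * Real.exp (-L) * Real.exp (-L) := by
          rw [← Real.exp_nat_mul, ← Real.exp_add, ← Real.exp_add]; congr 1; push_cast; ring
        rw [this]
        have h4 : Real.exp (-L) ^ 4 ≤ 1 := pow_le_one₀ (Real.exp_pos _).le (by linarith)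
        have h0 := Real.exp_pos (-L)
        nlinarith [mul_le_mul_of_nonneg_right h4 h0.le]
      calc sampleLaw μ D m (⋃ k, (B k ∪ B' k))
          ≤ ∑ k, sampleLaw μ D m (B k ∪ B' k) := measure_iUnion_fintype_le _ _
        _ ≤ ∑ _k : Fin p, ENNReal.ofReal (δ / p) := by
            refine Finset.sum_le_sum fun k _ => (measure_union_le _ _).trans ?_
            refine (add_le_add (hBk k) (hBk' k)).trans ?_
            rw [← ENNReal.ofReal_add (Real.exp_pos _).le (Real.exp_pos _).le]
            exact ENNReal.ofReal_le_ofReal (by linarith)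
        _ = ENNReal.ofReal δ := by
            rw [Finset.sum_const, Finset.card_univ, Fintype.card_fin, nsmul_eq_mul,
              ← ENNReal.ofReal_natCast, ← ENNReal.ofReal_mul hp'.le]
            congr 1
            field_simp

/-- The bound for losses `G k` that depend on the input only, in terms of the distribution-weighted
average of these losses. -/
theorem exists_weights_kde [SigmaFinite μ] (hp : 0 < p) (hm : 0 < m) (hD : ∀ k, Measurable (D k))
    (hD1 : ∀ k, ∫⁻ x, (D k x : ℝ≥0∞) ∂μ = 1) (hK : Measurable (uncurry K))
    (hKpos : ∀ x x', 0 < K x x') (hK1 : ∀ x', ∫⁻ x, (K x x' : ℝ≥0∞) ∂μ = 1)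
    {ε M : ℝ≥0} (hε : 0 < ε) {G : Fin p → X → ℝ≥0} (hG : ∀ k, Measurable (G k))
    (hGM : ∀ k x, G k x ≤ M) (hDG : ∀ k, ∫⁻ x, (D k x * G k x : ℝ≥0) ∂μ ≤ ε) :
    ∃ z : Fin p → ℝ≥0, (∀ k, 0 < z k) ∧ ∑ k, z k = 1 ∧ ∀ δ : ℝ, 0 < δ →
      ENNReal.ofReal (1 - δ) ≤ sampleLaw μ D m {S | ∀ i,
        ∫⁻ x, (D i x * gmsa z (kde K S) G x : ℝ≥0) ∂μ ≤ gmsaBound μ m D K ε M δ} := by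
  have hX : Nonempty X := by
    by_contra hX
    rw [not_nonempty_iff] at hX
    simpa [Measure.eq_zero_of_isEmpty μ] using hD1 ⟨0, hp⟩
  obtain ⟨z, hz0, hz1, hz⟩ : ∃ z : Fin p → ℝ≥0, (∀ k, 0 < z k) ∧ ∑ k, z k = 1 ∧ (ε ≤ M → ∀ i,
      ∫⁻ x, (D i x * gmsa z D G x : ℝ≥0) ∂μ
        ≤ ENNReal.ofReal (9 / 8 * (ε * (1 + Real.log (M / ε))))) := by
    by_cases hεM : ε ≤ M
    · obtain ⟨z, h0, h1, h⟩ := exists_weights hp hD hG hD1 hε hεM hGM hDG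
      exact ⟨z, h0, h1, fun _ => h⟩
    · have hp' : (p : ℝ≥0) ≠ 0 := by exact_mod_cast hp.ne'
      exact ⟨fun _ => (p : ℝ≥0)⁻¹, fun _ => by positivity, by simp [hp'], fun h => absurd h hεM⟩
  refine ⟨z, hz0, hz1, fun δ hδ => ?_⟩
  have := isProbabilityMeasure_labeledLaw hp hD1
  have hprob : IsProbabilityMeasure (sampleLaw μ D m) := by
    unfold sampleLaw; infer_instance
  have hof : ∀ {b : ℝ≥0∞}, (∀ (S : Fin m → X × Fin p) (i : Fin p),
      ∫⁻ x, (D i x * gmsa z (kde K S) G x : ℝ≥0) ∂μ ≤ b) →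
      ENNReal.ofReal (1 - δ) ≤ sampleLaw μ D m {S | ∀ i,
        ∫⁻ x, (D i x * gmsa z (kde K S) G x : ℝ≥0) ∂μ ≤ b} := by
    intro b hall
    rw [Set.eq_univ_of_forall (s := {S | ∀ i, _}) hall, measure_univ]
    exact ENNReal.ofReal_le_one.2 (by linarith)
  have hMof : ∀ {b : ℝ≥0∞}, (M : ℝ≥0∞) ≤ b →
      ENNReal.ofReal (1 - δ) ≤ sampleLaw μ D m {S | ∀ i,
        ∫⁻ x, (D i x * gmsa z (kde K S) G x : ℝ≥0) ∂μ ≤ b} := fun hb =>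
    hof fun S i => (lintegral_mul_gmsa_le_bound hD hD1 hGM z _ i).trans hb
  rcases le_or_gt 1 δ with hδ1 | hδ1
  · rw [ENNReal.ofReal_of_nonpos (by linarith)]
    exact zero_le
  rcases eq_zero_or_pos M with hM0 | hM0
  · exact hMof (by simp [hM0])
  have hds := one_le_dStar hp hD hD1 hK hK1
  have hds' := one_le_dStar' hp hD hD1 hK hK1
  have hκs := one_le_kappa hKpos
  by_cases htop : dStar μ D K = ∞ ∨ dStar' μ D K = ∞ ∨ kappa K = ∞
  · rw [gmsaBound_eq_top hp hm hds hds' hε hM0 hδ hδ1 htop]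
    exact hMof le_top
  push Not at htop
  obtain ⟨htop1, htop2, htop3⟩ := htop
  obtain ⟨d, hd⟩ : ∃ r : ℝ≥0, (r : ℝ≥0∞) = dStar μ D K := ⟨_, ENNReal.coe_toNNReal htop1⟩
  obtain ⟨d', hd'⟩ : ∃ r : ℝ≥0, (r : ℝ≥0∞) = dStar' μ D K := ⟨_, ENNReal.coe_toNNReal htop2⟩
  obtain ⟨κ, hκ⟩ : ∃ r : ℝ≥0, (r : ℝ≥0∞) = kappa K := ⟨_, ENNReal.coe_toNNReal htop3⟩
  rw [gmsaBound_eq_ofReal hκ.symm hd.symm hd'.symm]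
  have hd1 : 1 ≤ d := by rw [← hd] at hds; exact_mod_cast hds
  have hd1' : 1 ≤ d' := by rw [← hd'] at hds'; exact_mod_cast hds'
  have hκ1 : 1 ≤ κ := by rw [← hκ] at hκs; exact_mod_cast hκs
  have hP : 1 ≤ d * d' := one_le_mul hd1 hd1'
  obtain ⟨v, hv, hvA⟩ := exists_fourth_root hε M
  set E : ℝ := κ * (6 / √(2 * ((m : ℝ) / (p : ℝ))) * √(Real.log p + Real.log (1 / δ))) with hE
  have hE1 : 1 ≤ Real.exp E := Real.one_le_exp (by positivity)
  have hbound : ∀ q : ℝ≥0, q ≤ d * d' * (ε ^ (1 / 4 : ℝ) * M ^ (3 / 4 : ℝ)) → (q : ℝ≥0∞) ≤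
      ENNReal.ofReal (Real.exp E * (d * d') * (ε ^ (1 / 4 : ℝ) * M ^ (3 / 4 : ℝ) : ℝ≥0)) := by
    intro q hq
    rw [← ENNReal.ofReal_coe_nnreal]
    refine ENNReal.ofReal_le_ofReal ?_
    calc (q : ℝ) ≤ (d * d' * (ε ^ (1 / 4 : ℝ) * M ^ (3 / 4 : ℝ)) : ℝ≥0) := by exact_mod_cast hq
      _ = 1 * (d * d') * (ε ^ (1 / 4 : ℝ) * M ^ (3 / 4 : ℝ) : ℝ≥0) := by push_cast; ring
      _ ≤ _ := by gcongr
  rcases le_total v (d * d') with hvP | hvP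
  · -- the maximal loss is already below the bound
    refine hMof (hbound M ?_)
    rw [hvA, hv]
    calc ε * v ^ 4 = v * (ε * v ^ 3) := by ring
      _ ≤ _ := by gcongr
  have hv1 : 1 ≤ v := hP.trans hvP
  have hεA : ε ≤ ε ^ (1 / 4 : ℝ) * M ^ (3 / 4 : ℝ) := by
    rw [hvA]; exact le_mul_of_one_le_right' (one_le_pow₀ hv1)
  have hεM : ε ≤ M := by
    rw [hv]; exact le_mul_of_one_le_right' (one_le_pow₀ hv1)
  rcases (show p = 1 ∨ 2 ≤ p by omega) with hp1 | hp2
  · -- With a single source the combination is the given predictor. The union bound would fail here: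
    -- it needs `log (p / δ)` to be bounded away from zero.
    subst hp1
    refine hof fun S i => le_trans ?_ (hbound ε (hεA.trans (le_mul_of_one_le_left' hP)))
    refine le_trans (lintegral_mono fun x => ?_) (hDG i)
    have : gmsa z (kde K S) G x ≤ G i x := gmsa_le fun k => by rw [Subsingleton.elim k i]
    rw [ENNReal.coe_le_coe]
    gcongr
  choose g hg hg1 hgκ hgK hgd using
    exists_dominating_left hD hD1 hK hKpos hK1 hκ.symm hd.symm
  choose g' hg' hgκ' hgK' hgd' using
    exists_dominating_right hD hD1 hK hKpos hκ.symm hd'.symm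
  have hA : ∀ i, ∫⁻ x, (D i x * gmsa z D G x : ℝ≥0) ∂μ
      ≤ (ε ^ (1 / 4 : ℝ) * M ^ (3 / 4 : ℝ) : ℝ≥0) := fun i => by
    refine lintegral_mul_gmsa_le_geom_mean hD hG hε hDG hz1 hP ?_ (hz hεM i) fun hP32 j => ?_
    · rw [hv]; gcongr
    · refine ae_le_sq_mul_of_forall_ae_le (hD i) (hD j) (hg' i) (hg j) (hD1 i) (hD1 j)
        (fun x => ?_) (hg1 j) hd1 hd1' (hgd' i) (hgd j) hP32
      filter_upwards [hgK' i x, hgK j x] with u h1 h2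
      calc D i u ≤ g' i x * K u x := h1
        _ ≤ g' i x * (g j x * D j u) := by gcongr
        _ = _ := by ring
  exact sampleLaw_loss_le hp2 hm hD hD1 hKpos hκ1 hd1 hd1'
    (fun u x x' => by
      have := kernel_le_kappa_mul hKpos u x x'
      rw [← hκ] at this
      exact_mod_cast this)
    hg hgκ hgK hgd hg' hgκ' hgK' hgd' hG hεA hDG hz0 hA hδ hδ1

end Core

/-! ### Reduction of the two models -/

section Models

/-- Jensen's inequality for convex combinations with coefficients in `ℝ≥0`, and values that need
not lie in a group. -/
lemma convexOn_nnreal_map_sum_le {ι E β : Type*} [AddCommMonoid E] [Module ℝ≥0 E]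
    [AddCommMonoid β] [PartialOrder β] [IsOrderedAddMonoid β] [Module ℝ≥0 β]
    [PosSMulMono ℝ≥0 β] {s : Set E} {f : E → β}
    (hf : ConvexOn ℝ≥0 s f) (t : Finset ι) (w : ι → ℝ≥0) (q : ι → E) (hw : ∑ i ∈ t, w i = 1)
    (hq : ∀ i ∈ t, q i ∈ s) :
    ∑ i ∈ t, w i • q i ∈ s ∧ f (∑ i ∈ t, w i • q i) ≤ ∑ i ∈ t, w i • f (q i) := by
  classical
  induction t using Finset.induction_on generalizing w with
  | empty => simp at hw
  | insert a t ha ih =>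
    have hqa := hq a (Finset.mem_insert_self a t)
    have hqt : ∀ i ∈ t, q i ∈ s := fun i hi => hq i (Finset.mem_insert_of_mem hi)
    rw [Finset.sum_insert ha] at hw
    rw [Finset.sum_insert ha, Finset.sum_insert ha]
    set v := ∑ i ∈ t, w i with hv
    rcases eq_or_ne v 0 with h0 | h0
    · have hz : ∀ i ∈ t, w i = 0 := Finset.sum_eq_zero_iff.1 (hv ▸ h0)
      have h1 : w a = 1 := by rwa [h0, add_zero] at hw
      rw [Finset.sum_eq_zero fun i hi => by rw [hz i hi, zero_smul],
        Finset.sum_eq_zero fun i hi => by rw [hz i hi, zero_smul], h1]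
      simpa using hqa
    · have hs : ∑ i ∈ t, w i / v = 1 := by rw [← Finset.sum_div, ← hv, div_self h0]
      obtain ⟨hm, hle⟩ := ih (fun i => w i / v) hs hqt
      have e1 : ∑ i ∈ t, w i • q i = v • ∑ i ∈ t, (w i / v) • q i := by
        rw [Finset.smul_sum]
        exact Finset.sum_congr rfl fun i _ => by rw [smul_smul, mul_div_cancel₀ _ h0]
      have e2 : ∑ i ∈ t, w i • f (q i) = v • ∑ i ∈ t, (w i / v) • f (q i) := by
        rw [Finset.smul_sum]
        exact Finset.sum_congr rfl fun i _ => by rw [smul_smul, mul_div_cancel₀ _ h0]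
      rw [e1, e2]
      refine ⟨hf.1 hqa hm zero_le zero_le hw, (hf.2 hqa hm zero_le zero_le hw).trans ?_⟩
      gcongr

variable {X Y : Type*} [MeasurableSpace X] [MeasurableSpace Y]

lemma measurable_kde {K : X → X → ℝ≥0} (hK : Measurable (uncurry K)) {p m : ℕ}
    (S : Fin m → X × Fin p) (k : Fin p) : Measurable (kde K S k) := by
  have hKx : ∀ x, Measurable (fun u => K u x) := fun x =>
    hK.comp (measurable_id.prodMk measurable_const)
  exact (Finset.measurable_fun_sum _ fun i _ => hKx _).div_const _

/-- Both models reduce to a bound for the distribution-weighted averages of the losses `Λ k` of the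
given predictors, which dominate the loss of the combination by convexity. -/
theorem exists_weights_forall_le_average (μ : Measure X) [SigmaFinite μ] (η : Kernel X Y)
    [IsMarkovKernel η] {p m : ℕ} (hp : 0 < p) (hm : 0 < m) {D : Fin p → X → ℝ≥0}
    (hD : ∀ k, Measurable (D k)) (hD1 : ∀ k, ∫⁻ x, (D k x : ℝ≥0∞) ∂μ = 1) {K : X → X → ℝ≥0}
    (hK : Measurable (uncurry K)) (hKpos : ∀ x x', 0 < K x x')
    (hK1 : ∀ x', ∫⁻ x, (K x x' : ℝ≥0∞) ∂μ = 1) {ε M : ℝ≥0} (hε : 0 < ε)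
    {Λ : Fin p → X × Y → ℝ≥0∞} (hΛ : ∀ k, Measurable (Λ k)) (hΛM : ∀ k q, Λ k q ≤ M)
    (hΛε : ∀ k, ∫⁻ q, Λ k q ∂(domain μ η (D k)) ≤ ε) :
    ∃ z ∈ stdSimplex ℝ≥0 (Fin p), ∀ δ : ℝ, 0 < δ →
      ENNReal.ofReal (1 - δ) ≤ sampleLaw μ D m
        {S | (∀ x, ∑ k, z k * kde K S k x / ∑ j, z j * kde K S j x = 1) ∧
          ∀ w ∈ stdSimplex ℝ≥0 (Fin p), ∀ f : X × Y → ℝ≥0∞,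
            (∀ q, f q ≤ ∑ k, (z k * kde K S k q.1 / ∑ j, z j * kde K S j q.1 : ℝ≥0) • Λ k q) →
            ∫⁻ q, f q ∂(mixture μ η D w) ≤ gmsaBound μ m D K ε M δ} := by
  have hlaw : ∀ k, IsProbabilityMeasure (law μ (D k)) := fun k => isProbabilityMeasure_law (hD1 k)
  have hΓm : ∀ k, Measurable fun x => ∫⁻ y, Λ k (x, y) ∂(η x) := fun k =>
    (hΛ k).lintegral_kernel_prod_right'
  have hΓM : ∀ k x, ∫⁻ y, Λ k (x, y) ∂(η x) ≤ M := fun k x => by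
    calc ∫⁻ y, Λ k (x, y) ∂(η x) ≤ ∫⁻ _, (M : ℝ≥0∞) ∂(η x) := lintegral_mono fun y => hΛM k _
      _ = M := by simp
  set G : Fin p → X → ℝ≥0 := fun k x => (∫⁻ y, Λ k (x, y) ∂(η x)).toNNReal with hG
  have hGc : ∀ k x, (G k x : ℝ≥0∞) = ∫⁻ y, Λ k (x, y) ∂(η x) := fun k x =>
    ENNReal.coe_toNNReal (ne_top_of_le_ne_top ENNReal.coe_ne_top (hΓM k x))
  have hGm : ∀ k, Measurable (G k) := fun k => (hΓm k).ennreal_toNNReal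
  obtain ⟨z, hz0, hz1, hz⟩ := exists_weights_kde (μ := μ) (m := m) (K := K) (M := M) (G := G)
    hp hm hD hD1 hK hKpos hK1 hε hGm
    (fun k x => by rw [← ENNReal.coe_le_coe, hGc]; exact hΓM k x)
    (fun k => by
      refine le_trans (le_of_eq ?_) (hΛε k)
      rw [domain, Measure.lintegral_compProd (hΛ k), lintegral_law (hD k) (hΓm k)]
      simp only [ENNReal.coe_mul, hGc])
  refine ⟨z, ⟨fun _ => zero_le, hz1⟩, fun δ hδ => (hz δ hδ).trans (measure_mono ?_)⟩
  intro S hS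
  refine ⟨fun x => ?_, fun w hw f hf => ?_⟩
  · rw [← Finset.sum_div, div_self (sum_mul_kde_pos hm hKpos hz0 x).ne']
  set c : Fin p → X → ℝ≥0 := fun k x => z k * kde K S k x / ∑ j, z j * kde K S j x with hc
  have hcm : ∀ k, Measurable fun x => (c k x : ℝ≥0∞) := fun k =>
    ((measurable_kde hK S k).const_mul (z k) |>.div
      (Finset.measurable_fun_sum _ fun j _ =>
        (measurable_kde hK S j).const_mul (z j))).coe_nnreal_ennreal
  have hdom : ∀ i, ∫⁻ q, f q ∂(domain μ η (D i)) ≤ gmsaBound μ m D K ε M δ := by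
    intro i
    have hm1 : Measurable fun q : X × Y => ∑ k, (c k q.1 : ℝ≥0∞) * Λ k q :=
      Finset.measurable_fun_sum _ fun k _ => ((hcm k).comp measurable_fst).mul (hΛ k)
    refine le_trans ?_ (hS i)
    calc ∫⁻ q, f q ∂(domain μ η (D i))
        ≤ ∫⁻ q, ∑ k, (c k q.1 : ℝ≥0∞) * Λ k q ∂(domain μ η (D i)) :=
          lintegral_mono fun q => hf q
      _ = ∫⁻ x, D i x * ∫⁻ y, ∑ k, (c k x : ℝ≥0∞) * Λ k (x, y) ∂(η x) ∂μ := by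
          rw [domain, Measure.lintegral_compProd hm1,
            lintegral_law (hD i) hm1.lintegral_kernel_prod_right']
      _ = ∫⁻ x, (D i x * gmsa z (kde K S) G x : ℝ≥0) ∂μ := by
          refine lintegral_congr fun x => ?_
          have hΛx : ∀ k, Measurable fun y => Λ k (x, y) := fun k =>
            (hΛ k).comp measurable_prodMk_left
          rw [lintegral_finsetSum _ fun k _ => (hΛx k).const_mul _, gmsa, ENNReal.coe_mul,
            ENNReal.ofNNReal_finsetSum]
          congr 1
          refine Finset.sum_congr rfl fun k _ => ?_
          rw [lintegral_const_mul _ (hΛx k), smul_eq_mul, ENNReal.coe_mul, hGc]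
  rw [mixture, lintegral_finsetSum_measure]
  calc ∑ k, ∫⁻ q, f q ∂(w k • domain μ η (D k))
      ≤ ∑ k, (w k : ℝ≥0∞) * gmsaBound μ m D K ε M δ := by
        refine Finset.sum_le_sum fun k _ => ?_
        rw [lintegral_smul_measure, ENNReal.smul_def, smul_eq_mul]
        gcongr
        exact hdom k
    _ = _ := by rw [← Finset.sum_mul, ← ENNReal.ofNNReal_finsetSum, hw.2, ENNReal.coe_one, one_mul]

end Models

end MSA

theorem mainTheorem2 {X Y : Type*} [MeasurableSpace X] [MeasurableSpace Y]
    (μ : Measure X) [SigmaFinite μ] (η : Kernel X Y) [IsMarkovKernel η]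
    (p m : ℕ) (hp : 0 < p) (hm : 0 < m)
    (D : Fin p → X → ℝ≥0) (hD : ∀ k, Measurable (D k))
    (hD1 : ∀ k, ∫⁻ x, (D k x : ℝ≥0∞) ∂μ = 1)
    (K : X → X → ℝ≥0) (hK : Measurable (uncurry K)) (hKpos : ∀ x x', 0 < K x x')
    (hK1 : ∀ x', ∫⁻ x, (K x x' : ℝ≥0∞) ∂μ = 1)
    (ε M : ℝ≥0) (hε : 0 < ε) :
    -- the regression model
    (∀ (ℓ : ℝ → Y → ℝ≥0) (h : Fin p → X → ℝ),
      Measurable (uncurry ℓ) →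
      (∀ y, ConvexOn ℝ Set.univ (fun v => (ℓ v y : ℝ))) →
      (∀ y, Continuous (fun v => ℓ v y)) →
      (∀ k, Measurable (h k)) →
      (∀ k, MSA.lossR ℓ (MSA.domain μ η (D k)) (h k) ≤ ε) →
      (∀ k x y, ℓ (h k x) y ≤ M) →
      ∃ z ∈ stdSimplex ℝ≥0 (Fin p), ∀ δ : ℝ, 0 < δ →
        ENNReal.ofReal (1 - δ) ≤ MSA.sampleLaw μ D m
          {S | ∀ w ∈ stdSimplex ℝ≥0 (Fin p),
            MSA.lossR ℓ (MSA.mixture μ η D w) (MSA.gmsa z (MSA.kde K S) h)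
              ≤ MSA.gmsaBound μ m D K ε M δ}) ∧
    -- the probability model; the loss may take the value `∞`, as the log-loss does at `0`
    (∀ (ℓ : ℝ≥0 → ℝ≥0∞) (h : Fin p → X → Y → ℝ≥0),
      ConvexOn ℝ≥0 (Set.Icc 0 1) ℓ →
      ContinuousOn ℓ (Set.Icc 0 1) →
      (∀ k, Measurable (uncurry (h k))) →
      (∀ k x, HasSum (fun y => h k x y) 1) →
      (∀ k, MSA.lossP ℓ (MSA.domain μ η (D k)) (h k) ≤ ε) →
      (∀ k x y, ℓ (h k x y) ≤ M) →
      ∃ z ∈ stdSimplex ℝ≥0 (Fin p), ∀ δ : ℝ, 0 < δ →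
        ENNReal.ofReal (1 - δ) ≤ MSA.sampleLaw μ D m
          {S | ∀ w ∈ stdSimplex ℝ≥0 (Fin p),
            MSA.lossP ℓ (MSA.mixture μ η D w) (MSA.gmsa z (MSA.kde K S) h)
              ≤ MSA.gmsaBound μ m D K ε M δ}) := by
  refine ⟨fun ℓ h hℓ hconv _ hh hL hM => ?_, fun ℓ h hconv hcont hh hsum hL hM => ?_⟩
  · obtain ⟨z, hz, H⟩ := MSA.exists_weights_forall_le_average μ η hp hm hD hD1 hK hKpos hK1 hε
      (Λ := fun k q => (ℓ (h k q.1) q.2 : ℝ≥0∞)) (M := M)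
      (fun k => (hℓ.comp (((hh k).comp measurable_fst).prodMk measurable_snd)).coe_nnreal_ennreal)
      (fun k q => by exact_mod_cast hM k q.1 q.2) hL
    refine ⟨z, hz, fun δ hδ => (H δ hδ).trans (measure_mono ?_)⟩
    rintro S ⟨hS1, hS⟩ w hw
    refine hS w hw _ fun q => ?_
    have h1 : ∑ k, ((z k * MSA.kde K S k q.1 / ∑ j, z j * MSA.kde K S j q.1 : ℝ≥0) : ℝ) = 1 := by
      exact_mod_cast hS1 q.1
    have h2 := (hconv q.2).map_sum_le (t := Finset.univ) (p := fun k => h k q.1)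
      (fun k _ => NNReal.coe_nonneg _) h1 fun _ _ => Set.mem_univ _
    simp only [ENNReal.smul_def, smul_eq_mul, ← ENNReal.coe_mul, ← ENNReal.ofNNReal_finsetSum]
    rw [ENNReal.coe_le_coe, ← NNReal.coe_le_coe, NNReal.coe_sum]
    exact h2
  · have h01 : ∀ k x y, h k x y ∈ Set.Icc (0 : ℝ≥0) 1 := fun k x y =>
      ⟨zero_le, le_hasSum (hsum k x) y fun _ _ => zero_le⟩
    -- off the unit interval, where no prediction lies, the loss need not be measurable
    have hℓm : Measurable (Set.IccExtend zero_le_one ((Set.Icc (0 : ℝ≥0) 1).domRestrict ℓ)) :=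
      (hcont.domRestrict.Icc_extend' (h := zero_le_one)).measurable
    obtain ⟨z, hz, H⟩ := MSA.exists_weights_forall_le_average μ η hp hm hD hD1 hK hKpos hK1 hε
      (Λ := fun k q => ℓ (h k q.1 q.2)) (M := M)
      (fun k => by
        have e : (fun q : X × Y => ℓ (h k q.1 q.2)) = Set.IccExtend zero_le_one
            ((Set.Icc (0 : ℝ≥0) 1).domRestrict ℓ) ∘ uncurry (h k) := funext fun q =>
          (Set.IccExtend_of_mem zero_le_one ((Set.Icc (0 : ℝ≥0) 1).domRestrict ℓ)
            (h01 k q.1 q.2)).symm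
        rw [e]
        exact hℓm.comp (hh k))
      (fun k q => hM k q.1 q.2) hL
    refine ⟨z, hz, fun δ hδ => (H δ hδ).trans (measure_mono ?_)⟩
    rintro S ⟨hS1, hS⟩ w hw
    refine hS w hw _ fun q => ?_
    have h2 := (MSA.convexOn_nnreal_map_sum_le hconv Finset.univ _ (fun k => h k q.1 q.2)
      (hS1 q.1) fun k _ => h01 k q.1 q.2).2
    simpa only [MSA.gmsa, Finset.sum_apply, Pi.smul_apply] using h2
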